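/- Let $B$ be a (not necessarily unital) $C^*$-algebra and $E$ a Hilbert-$C^*$-module over $B$. An operator in $E$ is a $B$-linear map from a submodule $\mathcal D(A)\subset E$ to $E$; sums and products of operators carry their natural domains $\mathcal D(A+A')=\mathcal D(A)\cap\mathcal D(A')$, $\mathcal D(AA')=\{x\in\mathcal D(A') : A'x\in\mathcal D(A)\}$. The adjoint $A^*$ of a densely defined operator $A$ has as its domain the set of all $y\in E$ for which there is $z\in E$ with $\langle Ax,y\rangle=\langle x,z\rangle$ for all $x\in\mathcal D(A)$, and then $A^*y=z$. A densely defined operator $A$ is self-adjoint if $A=A^*$; it is regular if it is closed, $A^*$ is densely defined, and $1+A^*A$ has dense range. Let $S,T$ be self-adjoint regular operators in $E$ and put $$\mathcal F(S,T)=\{x\in\mathcal D(S)\cap\mathcal D(T) : Sx\in\mathcal D(T),\ Tx\in\mathcal D(S)\}.$$ Assume that the pair $(S,T)$ is weakly commuting, that is: 1. there are constants $C_0,C_1,C_2>0$ such that for all $x\in\mathcal F(S,T)$, as an inequality in $B$, $$\langle (ST-TS)x,(ST-TS)x\rangle\le C_0\langle x,x\rangle+C_1\langle Sx,Sx\rangle+C_2\langle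 Tx,Tx\rangle;$$ 2. there are a core $\mathcal E\subset\mathcal D(T)$ for $T$ and a number $\lambda_0>0$ such that $(S+\lambda)^{-1}(\mathcal E)\subset\mathcal F(S,T)$ for all $\lambda\in i\mathbb R$ with $|\lambda|\ge\lambda_0$. Then the operator $S^2+T^2$, with domain $\mathcal D(S^2)\cap\mathcal D(T^2)$, is self-adjoint and regular, and $$\mathcal D(S^2)\cap\mathcal D(T^2)=\mathcal D\bigl((S+iT)^*(S+iT)\bigr)=\mathcal D\bigl((S-iT)^*(S-iT)\bigr),$$ where $S\pm iT$ has domain $\mathcal D(S)\cap\mathcal D(T)$. -/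

import Mathlib

/-!
Unbounded operators in a Hilbert C⋆-module `E` over a (not necessarily unital) C⋆-algebra `B`.
Such an operator is a `ℂ`-linear partially defined map `E →ₗ.[ℂ] E`; being `B`-linear is a field
of `IsRegular`.
-/

namespace HilbertModule

section Composition

variable {E : Type*} [AddCommGroup E] [Module ℂ E]

/-- The product `g f` of two partially defined operators, on its natural domain
`{x ∈ D(f) | f x ∈ D(g)}`. -/
def mulOp (g f : E →ₗ.[ℂ] E) : E →ₗ.[ℂ] E where
  domain :=
    { carrier := {x | ∃ h : x ∈ f.domain, f ⟨x, h⟩ ∈ g.domain}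
      zero_mem' := ⟨f.domain.zero_mem, by
        have h : f ⟨0, f.domain.zero_mem⟩ = 0 := f.map_zero
        rw [h]; exact g.domain.zero_mem⟩
      add_mem' := by
        rintro x y ⟨hx, hx'⟩ ⟨hy, hy'⟩
        refine ⟨f.domain.add_mem hx hy, ?_⟩
        have h : f ⟨x + y, f.domain.add_mem hx hy⟩ = f ⟨x, hx⟩ + f ⟨y, hy⟩ :=
          f.map_add ⟨x, hx⟩ ⟨y, hy⟩
        rw [h]; exact g.domain.add_mem hx' hy'
      smul_mem' := by
        rintro c x ⟨hx, hx'⟩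
        refine ⟨f.domain.smul_mem c hx, ?_⟩
        have h : f ⟨c • x, f.domain.smul_mem c hx⟩ = c • f ⟨x, hx⟩ := f.map_smul c ⟨x, hx⟩
        rw [h]; exact g.domain.smul_mem c hx' }
  toFun :=
    { toFun := fun x => g ⟨f ⟨x, x.2.fst⟩, x.2.snd⟩
      map_add' := by
        rintro ⟨x, hx, hx'⟩ ⟨y, hy, hy'⟩
        have h : f ⟨x + y, f.domain.add_mem hx hy⟩ = f ⟨x, hx⟩ + f ⟨y, hy⟩ :=
          f.map_add ⟨x, hx⟩ ⟨y, hy⟩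
        rw [← g.map_add]
        congr 1
        exact Subtype.ext h
      map_smul' := by
        rintro c ⟨x, hx, hx'⟩
        have h : f ⟨c • x, f.domain.smul_mem c hx⟩ = c • f ⟨x, hx⟩ := f.map_smul c ⟨x, hx⟩
        rw [RingHom.id_apply, ← g.map_smul]
        congr 1
        exact Subtype.ext h }

theorem mem_mulOp_domain {g f : E →ₗ.[ℂ] E} {x : E} :
    x ∈ (mulOp g f).domain ↔ ∃ h : x ∈ f.domain, f ⟨x, h⟩ ∈ g.domain :=
  Iff.rfl

theorem mulOp_apply {g f : E →ₗ.[ℂ] E} {x : E} (h : x ∈ f.domain) (h' : f ⟨x, h⟩ ∈ g.domain) :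
    mulOp g f ⟨x, h, h'⟩ = g ⟨f ⟨x, h⟩, h'⟩ :=
  rfl

/-- The commutator `S T - T S`. Its domain is
`F(S, T) = {x ∈ D(S) ∩ D(T) | S x ∈ D(T), T x ∈ D(S)}`. -/
noncomputable def commutatorOp (S T : E →ₗ.[ℂ] E) : E →ₗ.[ℂ] E :=
  mulOp S T - mulOp T S

theorem mem_commutatorOp_domain {S T : E →ₗ.[ℂ] E} {x : E} :
    x ∈ (commutatorOp S T).domain ↔
      ∃ (hS : x ∈ S.domain) (hT : x ∈ T.domain), S ⟨x, hS⟩ ∈ T.domain ∧ T ⟨x, hT⟩ ∈ S.domain := by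
  constructor
  · rintro ⟨⟨hT, hT'⟩, hS, hS'⟩
    exact ⟨hS, hT, hS', hT'⟩
  · rintro ⟨hS, hT, hS', hT'⟩
    exact ⟨⟨hT, hT'⟩, hS, hS'⟩

end Composition

section Operators

variable (B : Type*) {E : Type*} [NonUnitalCStarAlgebra B] [PartialOrder B] [StarOrderedRing B]
  [NormedAddCommGroup E] [NormedSpace ℂ E] [SMul B E] [CStarModule B E]

/-- The graph of the adjoint: all `(y, z)` with `⟨T x, y⟩ = ⟨x, z⟩` in `B` for all `x ∈ D(T)`. -/
def adjointGraph (T : E →ₗ.[ℂ] E) : Submodule ℂ (E × E) where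
  carrier := {p | ∀ x : T.domain, inner B (T x) p.1 = inner B (x : E) p.2}
  zero_mem' := by intro x; simp
  add_mem' := by
    intro p q hp hq x
    simp [hp x, hq x]
  smul_mem' := by
    intro c p hp x
    simp [hp x]

/-- The adjoint `T*` of a densely defined operator `T`. Its domain is the set of all `y` for which
there is a `z` with `⟨T x, y⟩ = ⟨x, z⟩` for all `x ∈ D(T)`, and then `T* y = z`. -/
noncomputable def adjoint (T : E →ₗ.[ℂ] E) : E →ₗ.[ℂ] E :=
  (adjointGraph B T).toLinearPMap

theorem mem_adjoint_domain {T : E →ₗ.[ℂ] E} {y : E} :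
    y ∈ (adjoint B T).domain ↔ ∃ z : E, ∀ x : T.domain, inner B (T x) y = inner B (x : E) z := by
  simp [adjoint, adjointGraph, Submodule.toLinearPMap_domain]

/-- For densely defined `T`, the graph of `adjoint B T` is `adjointGraph B T`. -/
theorem mem_graph_adjoint {T : E →ₗ.[ℂ] E} (hT : Dense (T.domain : Set E)) {y z : E} :
    (y, z) ∈ (adjoint B T).graph ↔ ∀ x : T.domain, inner B (T x) y = inner B (x : E) z := by
  have key : ∀ p ∈ adjointGraph B T, p.1 = 0 → p.2 = 0 := by
    intro p hp h0
    have hz : ∀ x : E, inner B x p.2 = 0 := by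
      have hc : Continuous fun x : E => inner B x p.2 :=
        (CStarModule.continuous_inner (A := B) (E := E)).comp (by fun_prop : Continuous
          fun x : E => (x, p.2))
      have : (fun x : E => inner B x p.2) = fun _ => 0 := by
        refine Continuous.ext_on hT hc continuous_const ?_
        intro x hx
        have := hp ⟨x, hx⟩
        rw [h0] at this
        simpa using this.symm
      exact fun x => congrFun this x
    exact CStarModule.inner_self.1 (hz p.2)
  have hg : (adjoint B T).graph = adjointGraph B T :=
    Submodule.toLinearPMap_graph_eq _ key
  rw [hg]
  rfl

/-- A densely defined operator `T` is self-adjoint if `T* = T`, including equality of domains. -/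
structure IsSelfAdjointOp (T : E →ₗ.[ℂ] E) : Prop where
  dense_domain : Dense (T.domain : Set E)
  adjoint_eq : adjoint B T = T

/-- An operator `T` in a Hilbert C⋆-module is regular if it is a densely defined, closed
`B`-linear operator whose adjoint is densely defined and for which `1 + T* T` has dense range. -/
structure IsRegular (T : E →ₗ.[ℂ] E) : Prop where
  dense_domain : Dense (T.domain : Set E)
  smul_mem : ∀ (b : B) (x : E), x ∈ T.domain → b • x ∈ T.domain
  map_smul : ∀ (b : B) (x : E) (hx : x ∈ T.domain),
    T ⟨b • x, smul_mem b x hx⟩ = b • T ⟨x, hx⟩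
  isClosed : T.IsClosed
  dense_adjoint_domain : Dense ((adjoint B T).domain : Set E)
  dense_range : Dense (Set.range fun x : (mulOp (adjoint B T) T).domain =>
    (x : E) + mulOp (adjoint B T) T x)

/-- The pair `(S, T)` of self-adjoint regular operators is weakly commuting.

The set `{x ∈ D(S) | (S + λ) x ∈ 𝓔}` of the last field is `(S + λ)⁻¹ 𝓔`, for `λ = i t`. -/
structure IsWeaklyCommuting (S T : E →ₗ.[ℂ] E) : Prop where
  selfAdjoint_left : IsSelfAdjointOp B S
  regular_left : IsRegular B S
  selfAdjoint_right : IsSelfAdjointOp B T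
  regular_right : IsRegular B T
  form_estimate : ∃ C₀ C₁ C₂ : ℝ, 0 < C₀ ∧ 0 < C₁ ∧ 0 < C₂ ∧
    ∀ (x : E) (hx : x ∈ (commutatorOp S T).domain) (hS : x ∈ S.domain) (hT : x ∈ T.domain),
      inner B (commutatorOp S T ⟨x, hx⟩) (commutatorOp S T ⟨x, hx⟩) ≤
        C₀ • inner B x x + C₁ • inner B (S ⟨x, hS⟩) (S ⟨x, hS⟩)
          + C₂ • inner B (T ⟨x, hT⟩) (T ⟨x, hT⟩)
  core_condition : ∃ 𝓔 : Submodule ℂ E, T.HasCore 𝓔 ∧ ∃ l₀ : ℝ, 0 < l₀ ∧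
    ∀ t : ℝ, l₀ ≤ |t| → ∀ x : S.domain,
      S x + (Complex.I * (t : ℂ)) • (x : E) ∈ 𝓔 → (x : E) ∈ (commutatorOp S T).domain

end Operators

end HilbertModule

set_option linter.unusedSectionVars false

/-! Write `D_ζ = S + ζT` on `D(S) ∩ D(T)` for `ζ = ±i`. Formally `D_{-ζ} D_ζ = S² + T² + ζ[S,T]`.
Pairing `(μ² + S² + T²)x` with `x` controls `x`, `Sx` and `Tx`, so the commutator is a small
perturbation of `μ² + S² + T²` for large `μ`. It remains to solve the first order equations, to
identify `D_ζ* = D_{-ζ}`, and to show that `D_ζ x ∈ D(S) ∩ D(T)` forces `Sx, Tx ∈ D(S) ∩ D(T)`.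

In a Hilbert module a closed submodule need not be complemented, so solvability is proved directly.
A change of variables turns the pair `D_i, D_{-i}` into the matrix `[[T, S], [S, -T]] + iμ`.
Replacing `S` by its bounded Yosida approximation `σ_ε = S(1 + iεS)⁻¹` gives a system solvable by
continuity. Weak commutation reduces its cross terms to one pairing with a commutator, which a large
`|μ|` absorbs uniformly in `ε` (`exists_first_order_estimate`). Letting `ε → 0` bounds the true
matrix below, so its range is closed. Applying `σ_ε` to the regularized system gives a second
estimate of the same kind, and with it the smoothed solutions solve the true system up to `O(ε)`
(`exists_approx_firstOrder`), so the range is dense. Hence `exists_surjective_firstOrder`.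

Surjectivity yields the adjoint (`exists_of_inner_addSMul_eq`), second order regularity
(`exists_secondOrderGraph`) and the surjectivity of `μ² + S² + T²`
(`exists_surjective_shiftedLaplacian`). With symmetry and density this makes `S² + T²` self-adjoint,
and positivity makes it regular. Uniqueness for `μ² + S² + T²` places `D(S²) ∩ D(T²)` inside the
domain of all second order products (`exists_secondOrderGraph_of_mem`), which gives the equalities
of domains. -/

namespace HilbertModule

open Complex Filter Topology

/-! ### Surjectivity under perturbation. -/

section Continuity

/-- If `A` is surjective and `K` is bounded relative to `A` with relative bound less than one,
then `A + K` is surjective. -/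
theorem surjective_add_of_norm_le {V X : Type*} [AddCommGroup V] [Module ℂ V]
    [NormedAddCommGroup X] [NormedSpace ℂ X] [CompleteSpace X] (A K : V →ₗ[ℂ] X)
    (hA : Function.Surjective A) {θ : ℝ} (hθ0 : 0 ≤ θ) (hθ : θ < 1)
    (hK : ∀ v, ‖K v‖ ≤ θ * ‖A v‖) : Function.Surjective (A + K) := by
  intro y
  choose g hg using hA
  -- The section `g` of `A` need not be linear: the bound on `K` is in terms of `A`, so it sees only
  -- `A (g z' - g z) = z' - z`. At a fixed point `z`, `(A + K)(g z) = z + K (g z) = y`.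
  have hc : ContractingWith ⟨θ, hθ0⟩ (fun z => y - K (g z)) := by
    refine ⟨by exact_mod_cast hθ, LipschitzWith.of_dist_le_mul fun z z' => ?_⟩
    have h := hK (g z' - g z)
    rw [map_sub, map_sub, hg, hg] at h
    rw [dist_eq_norm, dist_eq_norm, norm_sub_rev z z']
    rw [sub_sub_sub_cancel_left]
    exact h
  refine ⟨g (hc.fixedPoint), ?_⟩
  have h : y - K (g (hc.fixedPoint)) = hc.fixedPoint := hc.fixedPoint_isFixedPt
  rw [LinearMap.add_apply, hg]
  nth_rewrite 1 [← h]
  abel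

/-- The method of continuity along the segment from `A` to `A + K`. -/
theorem surjective_add_of_path {V X : Type*} [AddCommGroup V] [Module ℂ V]
    [NormedAddCommGroup X] [NormedSpace ℂ X] [CompleteSpace X] (A K : V →ₗ[ℂ] X)
    (hA : Function.Surjective A) {M : ℝ}
    (hK : ∀ s : ℝ, 0 ≤ s → s ≤ 1 → ∀ v, ‖K v‖ ≤ M * ‖A v + (s : ℂ) • K v‖) :
    Function.Surjective (A + K) := by
  obtain ⟨N, hN⟩ := exists_nat_gt (max M 1)
  have hN1 : (1 : ℝ) < N := lt_of_le_of_lt (le_max_right _ _) hN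
  have hNM : M < N := lt_of_le_of_lt (le_max_left _ _) hN
  have hN0 : (0 : ℝ) < N := by linarith
  -- Each of the `N` steps adds `K / N`, of relative bound `max M 0 / N < 1`; the maximum covers a
  -- negative `M`.
  have key : ∀ k : ℕ, k ≤ N → Function.Surjective (A + (((k : ℝ) / N : ℝ) : ℂ) • K) := by
    intro k
    induction k with
    | zero => intro _; simpa using hA
    | succ k ih =>
      intro hk
      have hkN : (k : ℝ) / N ≤ 1 := by
        rw [div_le_one hN0]; exact_mod_cast (Nat.le_of_succ_le hk)
      have h := surjective_add_of_norm_le (A + (((k : ℝ) / N : ℝ) : ℂ) • K)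
        (((1 / N : ℝ) : ℂ) • K) (ih (Nat.le_of_succ_le hk)) (θ := max M 0 / N)
        (by positivity) (by rw [div_lt_one hN0]; exact max_lt hNM hN0) (fun v => by
          have h := hK (k / N) (by positivity) hkN v
          rw [LinearMap.smul_apply, norm_smul, norm_real, Real.norm_of_nonneg (by positivity),
            LinearMap.add_apply, LinearMap.smul_apply, div_mul_eq_mul_div, one_mul,
            div_mul_eq_mul_div]
          gcongr
          exact h.trans (by gcongr; exact le_max_left _ _))
      have e : (A + (((k : ℝ) / N : ℝ) : ℂ) • K) + ((1 / N : ℝ) : ℂ) • K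
          = A + ((((k + 1 : ℕ) : ℝ) / N : ℝ) : ℂ) • K := by
        rw [add_assoc, ← add_smul, ← ofReal_add, ← add_div]
        push_cast
        rfl
      rwa [e] at h
  have h := key N le_rfl
  rw [div_self hN0.ne'] at h
  simpa using h

end Continuity

/-! ### From inequalities in `B` to norms in `E`. -/

section Norm

variable (B : Type*) {E : Type*} [NonUnitalCStarAlgebra B] [PartialOrder B] [StarOrderedRing B]
  [NormedAddCommGroup E] [NormedSpace ℂ E] [SMul B E] [CStarModule B E]

/-- The norm of `B` is monotone on the positive cone; every norm estimate below drops positive terms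
in `B` first and then passes through this. -/
theorem norm_sq_le_norm_of_inner_le {x : E} {q : B} (h : inner B x x ≤ q) : ‖x‖ ^ 2 ≤ ‖q‖ := by
  rw [CStarModule.norm_sq_eq B]
  exact CStarAlgebra.norm_le_norm_of_nonneg_of_le CStarModule.inner_self_nonneg h

theorem ext_inner_left {x y : E} (h : ∀ z, inner B z x = inner B z y) : x = y := by
  have h' := h (x - y)
  rw [← sub_eq_zero, ← CStarModule.inner_sub_right] at h'
  exact sub_eq_zero.1 (CStarModule.inner_self.1 h')

/-- The action of `B` is known only through the inner product, so additivity comes from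
nondegeneracy. -/
theorem smul_add_of_inner (b : B) (x y : E) : b • (x + y) = b • x + b • y :=
  ext_inner_left B fun z => by simp [mul_add]

/-- A symmetric pair shifted by an imaginary number. -/
theorem inner_add_imaginary_smul {a b u v : E} (μ : ℝ)
    (h : inner B a u + inner B b v = inner B u a + inner B v b) :
    inner B (a + (μ * I) • u) (a + (μ * I) • u) + inner B (b + (μ * I) • v) (b + (μ * I) • v) =
      inner B a a + inner B b b + inner B ((μ : ℂ) • u) ((μ : ℂ) • u)
        + inner B ((μ : ℂ) • v) ((μ : ℂ) • v) := by
  -- The cross terms of the expansion are `μ i` times the difference of the two sides of `h`. Only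
  -- the sum over both rows has to be symmetric, as for a symmetric 2×2 matrix.
  have h2 : (μ * I) • (inner B a u + inner B b v) = (μ * I) • (inner B u a + inner B v b) := by
    rw [h]
  simp only [CStarModule.inner_add_left, CStarModule.inner_add_right,
    CStarModule.inner_smul_left_complex, CStarModule.inner_smul_right_complex, star_mul',
    RCLike.star_def, conj_ofReal, conj_I, smul_smul, smul_add] at h2 ⊢
  have e1 : (μ : ℂ) * I * (μ * -I) = μ * μ := by linear_combination (-μ * μ : ℂ) * I_mul_I
  have e2 : (μ : ℂ) * -I = -(μ * I) := by ring
  simp only [e1]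
  simp only [e2, neg_smul]
  rw [← sub_eq_zero] at h2 ⊢
  rw [← h2]
  abel

end Norm

/-! ### Resolvents and Yosida approximations of a self-adjoint graph. -/

section Yosida

variable (B : Type*) {E : Type*} [NonUnitalCStarAlgebra B] [PartialOrder B] [StarOrderedRing B]
  [NormedAddCommGroup E] [NormedSpace ℂ E] [SMul B E] [CStarModule B E]

/-- The graph of a self-adjoint regular operator: symmetric, closed, with dense domain, and such
that `1 + i ε G` is surjective for every real `ε ≠ 0`. -/
structure IsSelfAdjointGraph (G : Submodule ℂ (E × E)) : Prop where
  symm : ∀ {x a y b : E}, (x, a) ∈ G → (y, b) ∈ G → inner B a y = inner B x b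
  isClosed : IsClosed (G : Set (E × E))
  dense : Dense {x : E | ∃ a, (x, a) ∈ G}
  surj : ∀ ε : ℝ, ε ≠ 0 → ∀ x : E, ∃ p a, (p, a) ∈ G ∧ p + (ε * I) • a = x

open Classical in
/-- The pair `((1 + i ε G)⁻¹ x, G (1 + i ε G)⁻¹ x)`. -/
noncomputable def resolventPair (G : Submodule ℂ (E × E)) (ε : ℝ) (x : E) : E × E :=
  -- The default `0` is never met for a self-adjoint graph and `ε ≠ 0`.
  if h : ∃ p : E × E, p ∈ G ∧ p.1 + (ε * I) • p.2 = x then h.choose else 0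

/-- The smoothing operator `(1 + i ε G)⁻¹`. -/
noncomputable def smoothing (G : Submodule ℂ (E × E)) (ε : ℝ) (x : E) : E :=
  (resolventPair G ε x).1

/-- The Yosida approximation `G (1 + i ε G)⁻¹`. -/
noncomputable def yosida (G : Submodule ℂ (E × E)) (ε : ℝ) (x : E) : E :=
  (resolventPair G ε x).2

namespace IsSelfAdjointGraph

variable {B} {G : Submodule ℂ (E × E)} (hG : IsSelfAdjointGraph B G) {ε : ℝ}
include hG

/-- By symmetry the cross terms cancel: `⟨x, x⟩ = ⟨p, p⟩ + ε²⟨a, a⟩`. -/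
theorem norm_le_of_eq {p a x : E} (h : (p, a) ∈ G) (hx : p + (ε * I) • a = x) :
    ‖p‖ ≤ ‖x‖ ∧ |ε| * ‖a‖ ≤ ‖x‖ := by
  have key : inner B x x = inner B p p + inner B ((ε : ℂ) • a) ((ε : ℂ) • a) := by
    rw [← hx]
    have hs := hG.symm h h
    simp only [CStarModule.inner_add_left, CStarModule.inner_add_right,
      CStarModule.inner_smul_left_complex, CStarModule.inner_smul_right_complex, star_mul',
      RCLike.star_def, conj_ofReal, conj_I, smul_smul, hs]
    have e1 : (ε : ℂ) * I * (ε * -I) = ε * ε := by linear_combination (-ε * ε : ℂ) * I_mul_I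
    have e2 : (ε : ℂ) * -I = -(ε * I) := by ring
    simp only [smul_add, smul_smul, e1]
    simp only [e2, neg_smul]
    abel
  have hp : inner B p p ≤ inner B x x := by
    rw [key]; exact le_add_of_nonneg_right CStarModule.inner_self_nonneg
  have ha : inner B ((ε : ℂ) • a) ((ε : ℂ) • a) ≤ inner B x x := by
    rw [key]; exact le_add_of_nonneg_left CStarModule.inner_self_nonneg
  have hp' := norm_sq_le_norm_of_inner_le B hp
  have ha' := norm_sq_le_norm_of_inner_le B ha
  rw [← CStarModule.norm_sq_eq B] at hp' ha'
  refine ⟨le_of_sq_le_sq hp' (norm_nonneg _), ?_⟩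
  have := le_of_sq_le_sq ha' (norm_nonneg _)
  rwa [norm_smul, norm_real, Real.norm_eq_abs] at this

/-- A pair `(0, c)` in a symmetric graph has `c` orthogonal to the domain, which is dense. -/
theorem eq_of_mem {x a a' : E} (h : (x, a) ∈ G) (h' : (x, a') ∈ G) : a = a' := by
  have h0 : ((0 : E), a - a') ∈ G := by simpa using G.sub_mem h h'
  have key : ∀ z ∈ {x : E | ∃ a, (x, a) ∈ G}, inner B z (a - a') = 0 := by
    rintro z ⟨b, hb⟩
    simpa using (hG.symm hb h0).symm
  have hc : Continuous fun z : E => inner B z (a - a') :=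
    (CStarModule.continuous_inner (A := B) (E := E)).comp (by fun_prop : Continuous
      fun z : E => (z, a - a'))
  have h1 := congrFun (Continuous.ext_on hG.dense hc continuous_const key) (a - a')
  exact sub_eq_zero.1 (CStarModule.inner_self.1 h1)

section Nonzero

variable (hε : ε ≠ 0)
include hε

theorem resolventPair_spec (x : E) : (smoothing G ε x, yosida G ε x) ∈ G ∧
    smoothing G ε x + (ε * I) • yosida G ε x = x := by
  obtain ⟨p, a, h, h'⟩ := hG.surj ε hε x
  have hex : ∃ p : E × E, p ∈ G ∧ p.1 + (ε * I) • p.2 = x := ⟨(p, a), h, h'⟩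
  have := hex.choose_spec
  rw [smoothing, yosida, resolventPair, dif_pos hex]
  exact this

theorem mem (x : E) : (smoothing G ε x, yosida G ε x) ∈ G := (hG.resolventPair_spec hε x).1

theorem smoothing_add_yosida (x : E) : smoothing G ε x + (ε * I) • yosida G ε x = x :=
  (hG.resolventPair_spec hε x).2

/-- The difference of two solutions solves the homogeneous equation and is killed by the norm
bounds. Linearity of the resolvent and its commutation with `G` follow by exhibiting a solution. -/
theorem eq_resolventPair {p a x : E} (h : (p, a) ∈ G) (hx : p + (ε * I) • a = x) :
    smoothing G ε x = p ∧ yosida G ε x = a := by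
  have h1 := G.sub_mem (hG.mem hε x) h
  have h2 := hG.smoothing_add_yosida hε x
  have h3 : smoothing G ε x - p + (ε * I) • (yosida G ε x - a) = 0 := by
    rw [smul_sub]
    rw [← hx] at h2 ⊢
    rw [← sub_eq_zero] at h2
    rw [← h2]; abel
  obtain ⟨h4, h5⟩ := hG.norm_le_of_eq h1 h3
  rw [norm_zero] at h4 h5
  have h6 : ‖yosida G ε x - a‖ ≤ 0 := by
    by_contra hn
    have : 0 < |ε| * ‖yosida G ε x - a‖ := mul_pos (abs_pos.2 hε) (not_le.1 hn)
    linarith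
  exact ⟨sub_eq_zero.1 (norm_le_zero_iff.1 h4), sub_eq_zero.1 (norm_le_zero_iff.1 h6)⟩

theorem norm_smoothing_le (x : E) : ‖smoothing G ε x‖ ≤ ‖x‖ :=
  (hG.norm_le_of_eq (hG.mem hε x) (hG.smoothing_add_yosida hε x)).1

theorem norm_yosida_le (x : E) : |ε| * ‖yosida G ε x‖ ≤ ‖x‖ :=
  (hG.norm_le_of_eq (hG.mem hε x) (hG.smoothing_add_yosida hε x)).2

theorem resolventPair_add (x y : E) : smoothing G ε (x + y) = smoothing G ε x + smoothing G ε y ∧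
    yosida G ε (x + y) = yosida G ε x + yosida G ε y := by
  refine hG.eq_resolventPair hε (G.add_mem (hG.mem hε x) (hG.mem hε y)) ?_
  nth_rewrite 3 [← hG.smoothing_add_yosida hε x]
  nth_rewrite 3 [← hG.smoothing_add_yosida hε y]
  rw [smul_add]; abel

theorem resolventPair_smul (c : ℂ) (x : E) : smoothing G ε (c • x) = c • smoothing G ε x ∧
    yosida G ε (c • x) = c • yosida G ε x := by
  refine hG.eq_resolventPair hε (G.smul_mem c (hG.mem hε x)) ?_
  nth_rewrite 3 [← hG.smoothing_add_yosida hε x]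
  rw [smul_add, smul_comm]

theorem smoothing_add (x y : E) : smoothing G ε (x + y) = smoothing G ε x + smoothing G ε y :=
  (hG.resolventPair_add hε x y).1

theorem yosida_add (x y : E) : yosida G ε (x + y) = yosida G ε x + yosida G ε y :=
  (hG.resolventPair_add hε x y).2

theorem smoothing_smul (c : ℂ) (x : E) : smoothing G ε (c • x) = c • smoothing G ε x :=
  (hG.resolventPair_smul hε c x).1

theorem yosida_smul (c : ℂ) (x : E) : yosida G ε (c • x) = c • yosida G ε x :=
  (hG.resolventPair_smul hε c x).2

theorem smoothing_sub (x y : E) : smoothing G ε (x - y) = smoothing G ε x - smoothing G ε y := by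
  have := hG.smoothing_add hε x ((-1 : ℂ) • y)
  rw [hG.smoothing_smul hε] at this
  simpa [sub_eq_add_neg] using this

theorem yosida_sub (x y : E) : yosida G ε (x - y) = yosida G ε x - yosida G ε y := by
  have := hG.yosida_add hε x ((-1 : ℂ) • y)
  rw [hG.yosida_smul hε] at this
  simpa [sub_eq_add_neg] using this

/-- Expanding `x` and `y` in their resolvent pairs produces the same extra term `-iε⟨σ_ε x, σ_{-ε}
y⟩` on both sides. Because the adjoint has parameter `-ε`, the matrix below carries `σ_ε` in one
corner and `σ_{-ε}` in the other. -/
theorem inner_yosida_left (x y : E) :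
    inner B (yosida G ε x) y = inner B x (yosida G (-ε) y) := by
  have hε' : -ε ≠ 0 := neg_ne_zero.2 hε
  have hs := hG.symm (hG.mem hε x) (hG.mem hε' y)
  have h1 := congrArg (inner B (yosida G ε x)) (hG.smoothing_add_yosida hε' y)
  have h2 := congrArg (fun z => inner B z (yosida G (-ε) y)) (hG.smoothing_add_yosida hε x)
  rw [← h1, ← h2]
  simp only [CStarModule.inner_add_left, CStarModule.inner_add_right,
    CStarModule.inner_smul_left_complex, CStarModule.inner_smul_right_complex, star_mul',
    RCLike.star_def, conj_ofReal, conj_I, hs, ofReal_neg, neg_mul, mul_neg]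

/-- The smoothing operators commute with `G`. -/
theorem smoothing_mem {x a : E} (h : (x, a) ∈ G) :
    (smoothing G ε x, smoothing G ε a) ∈ G ∧ yosida G ε x = smoothing G ε a := by
  have h1 : (x - (ε * I) • smoothing G ε a, smoothing G ε a) ∈ G := by
    have := G.sub_mem h (G.smul_mem (ε * I) (hG.mem hε a))
    have e : a - (ε * I) • yosida G ε a = smoothing G ε a := by
      nth_rewrite 1 [← hG.smoothing_add_yosida hε a]; abel
    simpa [e] using this
  obtain ⟨h2, h3⟩ := hG.eq_resolventPair hε (x := x) h1 (by abel)
  rw [h2]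
  exact ⟨h1, h3⟩

theorem smoothing_comm {δ : ℝ} (hδ : δ ≠ 0) (x : E) :
    smoothing G δ (smoothing G ε x) = smoothing G ε (smoothing G δ x) ∧
      yosida G δ (smoothing G ε x) = smoothing G ε (yosida G δ x) := by
  refine hG.eq_resolventPair hδ (hG.smoothing_mem hε (hG.mem hδ x)).1 ?_
  rw [← hG.smoothing_smul hε, ← hG.smoothing_add hε, hG.smoothing_add_yosida hδ]

theorem yosida_comm {δ : ℝ} (hδ : δ ≠ 0) (x : E) :
    yosida G δ (yosida G ε x) = yosida G ε (yosida G δ x) := by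
  have h1 : (ε * I) • yosida G ε x = x - smoothing G ε x := by
    nth_rewrite 2 [← hG.smoothing_add_yosida hε x]; abel
  have h2 : (ε * I) • yosida G ε (yosida G δ x)
      = yosida G δ x - smoothing G ε (yosida G δ x) := by
    nth_rewrite 2 [← hG.smoothing_add_yosida hε (yosida G δ x)]; abel
  have h3 : (ε * I : ℂ) ≠ 0 := mul_ne_zero (ofReal_ne_zero.2 hε) I_ne_zero
  refine smul_right_injective E h3 ?_
  simp only
  rw [h2, ← hG.yosida_smul hδ, h1, hG.yosida_sub hδ, (hG.smoothing_comm hε hδ x).2]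

/-- Obtained by applying `σ_ε` to `1 = (1 - iεG)⁻¹ - iε σ_{-ε}`. It exchanges `σ_ε` for the smoothed
`σ_{-ε}` up to `ε` times a second order term. -/
theorem yosida_eq (x : E) : yosida G ε x = smoothing G ε (yosida G (-ε) x)
    - (ε * I) • yosida G ε (yosida G (-ε) x) := by
  have hε' : -ε ≠ 0 := neg_ne_zero.2 hε
  have h := congrArg (yosida G ε) (hG.smoothing_add_yosida hε' x)
  rw [hG.yosida_add hε, hG.yosida_smul hε] at h
  have h1 : yosida G ε (smoothing G (-ε) x) = smoothing G ε (yosida G (-ε) x) := by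
    rw [(hG.smoothing_mem hε (hG.mem hε' x)).2]
  rw [h1] at h
  rw [← h]
  simp [sub_eq_add_neg]

end Nonzero

theorem norm_smoothing_sub_le {x a : E} (hε : ε ≠ 0) (h : (x, a) ∈ G) :
    ‖smoothing G ε x - x‖ ≤ |ε| * ‖a‖ := by
  have h1 : smoothing G ε x - x = -((ε * I) • smoothing G ε a) := by
    nth_rewrite 2 [← hG.smoothing_add_yosida hε x]
    rw [(hG.smoothing_mem hε h).2]; abel
  rw [h1, norm_neg, norm_smul, norm_mul, norm_I, mul_one, norm_real, Real.norm_eq_abs]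
  gcongr
  exact hG.norm_smoothing_le hε a

theorem tendsto_smoothing (x : E) :
    Tendsto (fun ε => smoothing G ε x) (𝓝[≠] 0) (𝓝 x) := by
  rw [Metric.tendsto_nhds]
  intro r hr
  obtain ⟨y, ⟨a, hy⟩, hxy⟩ := Metric.mem_closure_iff.1 (hG.dense x) (r / 4) (by positivity)
  have h1 : Tendsto (fun ε : ℝ => |ε| * ‖a‖) (𝓝[≠] 0) (𝓝 0) := by
    have : Continuous fun ε : ℝ => |ε| * ‖a‖ := by fun_prop
    simpa using (this.tendsto 0).mono_left nhdsWithin_le_nhds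
  filter_upwards [h1.eventually (gt_mem_nhds (show 0 < r / 4 by positivity)),
    self_mem_nhdsWithin] with ε h2 h3
  have h3' : ε ≠ 0 := h3
  have h4 := hG.norm_smoothing_sub_le h3' hy
  have h5 := hG.norm_smoothing_le h3' (x - y)
  rw [hG.smoothing_sub h3'] at h5
  rw [dist_eq_norm] at hxy ⊢
  have : smoothing G ε x - x = (smoothing G ε x - smoothing G ε y) + (smoothing G ε y - y)
      + -(x - y) := by abel
  rw [this]
  refine (norm_add₃_le).trans_lt ?_
  rw [norm_neg]
  linarith

theorem tendsto_yosida {x a : E} (h : (x, a) ∈ G) :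
    Tendsto (fun ε => yosida G ε x) (𝓝[≠] 0) (𝓝 a) := by
  refine (hG.tendsto_smoothing a).congr' ?_
  filter_upwards [self_mem_nhdsWithin] with ε hε
  exact ((hG.smoothing_mem hε h).2).symm

end IsSelfAdjointGraph

end Yosida

/-! ### Smoothing and the commutator. -/

section Commutator

variable (B : Type*) {E : Type*} [NonUnitalCStarAlgebra B] [PartialOrder B] [StarOrderedRing B]
  [NormedAddCommGroup E] [NormedSpace ℂ E] [SMul B E] [CStarModule B E]

namespace IsSelfAdjointGraph

variable {B} {G : Submodule ℂ (E × E)} (hG : IsSelfAdjointGraph B G) {ε : ℝ}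
include hG

theorem continuous_smoothing (hε : ε ≠ 0) : Continuous (smoothing G ε) := by
  refine LipschitzWith.continuous (K := 1) (LipschitzWith.of_dist_le_mul fun x y => ?_)
  rw [dist_eq_norm, dist_eq_norm, ← hG.smoothing_sub hε]
  simpa using hG.norm_smoothing_le hε (x - y)

theorem norm_yosida_le' (hε : ε ≠ 0) (x : E) : ‖yosida G ε x‖ ≤ |ε|⁻¹ * ‖x‖ := by
  rw [inv_mul_eq_div, le_div_iff₀' (abs_pos.2 hε)]
  exact hG.norm_yosida_le hε x

theorem continuous_yosida (hε : ε ≠ 0) : Continuous (yosida G ε) := by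
  refine LipschitzWith.continuous (K := ⟨|ε|⁻¹, by positivity⟩)
    (LipschitzWith.of_dist_le_mul fun x y => ?_)
  rw [dist_eq_norm, dist_eq_norm, ← hG.yosida_sub hε]
  exact hG.norm_yosida_le' hε (x - y)

end IsSelfAdjointGraph

/-- Two self-adjoint graphs which commute weakly: the commutator is bounded relative to both, and
the resolvents of the first map a core of the second into the domain of the commutator. -/
structure IsWeaklyCommutingGraph (G H : Submodule ℂ (E × E)) : Prop where
  left : IsSelfAdjointGraph B G
  right : IsSelfAdjointGraph B H
  commutator_bound : ∃ κ : ℝ, 0 < κ ∧ ∀ {x a b c d : E}, (x, a) ∈ G → (x, b) ∈ H → (a, c) ∈ H →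
    (b, d) ∈ G → ‖d - c‖ ≤ κ * (‖x‖ + ‖a‖ + ‖b‖)
  core : ∃ 𝓖 : Set (E × E), 𝓖 ⊆ H ∧ (H : Set (E × E)) ⊆ closure 𝓖 ∧ ∃ δ : ℝ, 0 < δ ∧
    ∀ ε : ℝ, ε ≠ 0 → |ε| ≤ δ → ∀ p ∈ 𝓖, ∃ b c d,
      (smoothing G ε p.1, b) ∈ H ∧ (yosida G ε p.1, c) ∈ H ∧ (b, d) ∈ G

/-- `k` is the commutator of `G` and `H` at `(1 + i ε G)⁻¹ z`, where `H z = b`. -/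
structure IsSmoothedCommutator (G H : Submodule ℂ (E × E)) (ε : ℝ) (z b k : E) : Prop where
  smoothing_mem : (smoothing G ε z, smoothing G ε b + (ε * I) • smoothing G ε k) ∈ H
  yosida_mem : (yosida G ε z, yosida G ε b - smoothing G ε k) ∈ H
  mem : (smoothing G ε b + (ε * I) • smoothing G ε k,
    yosida G ε b - smoothing G ε k + k) ∈ G

variable {B}

theorem IsSmoothedCommutator.sub {G H : Submodule ℂ (E × E)} (hG : IsSelfAdjointGraph B G) {ε : ℝ}
    (hε : ε ≠ 0) {z b k z' b' k' : E} (h : IsSmoothedCommutator G H ε z b k)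
    (h' : IsSmoothedCommutator G H ε z' b' k') :
    IsSmoothedCommutator G H ε (z - z') (b - b') (k - k') := by
  constructor
  · convert H.sub_mem h.smoothing_mem h'.smoothing_mem using 1
    simp only [hG.smoothing_sub hε, smul_sub, Prod.mk_sub_mk, Prod.mk.injEq]
    exact ⟨trivial, by abel⟩
  · convert H.sub_mem h.yosida_mem h'.yosida_mem using 1
    simp only [hG.smoothing_sub hε, hG.yosida_sub hε, Prod.mk_sub_mk, Prod.mk.injEq]
    exact ⟨trivial, by abel⟩
  · convert G.sub_mem h.mem h'.mem using 1
    simp only [hG.smoothing_sub hε, hG.yosida_sub hε, smul_sub, Prod.mk_sub_mk, Prod.mk.injEq]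
    exact ⟨by abel, by abel⟩

namespace IsWeaklyCommutingGraph

variable {G H : Submodule ℂ (E × E)}

/-- Let `P = (1 + iεG)⁻¹` and `k = [G, H]Pz`. Then `(1 + iεG)HPz = b + iεk`, and applying `P` and
`GP` to this gives the formulas for `HPz`, `GHPz` and `HGPz`. -/
theorem isSmoothedCommutator_of_mem (hG : IsSelfAdjointGraph B G) (hH : IsSelfAdjointGraph B H)
    {ε : ℝ} (hε : ε ≠ 0) {z b b' c d : E} (hz : (z, b) ∈ H)
    (h1 : (smoothing G ε z, b') ∈ H) (h2 : (yosida G ε z, c) ∈ H) (h3 : (b', d) ∈ G) :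
    IsSmoothedCommutator G H ε z b (d - c) := by
  have e1 : b = b' + (ε * I) • c := by
    refine hH.eq_of_mem hz ?_
    have := H.add_mem h1 (H.smul_mem (ε * I) h2)
    simpa [hG.smoothing_add_yosida hε] using this
  have e2 : yosida G ε b' = smoothing G ε d := (hG.smoothing_mem hε h3).2
  have e3 : b' = smoothing G ε b + (ε * I) • smoothing G ε (d - c) := by
    nth_rewrite 1 [← hG.smoothing_add_yosida hε b']
    rw [e2, e1, hG.smoothing_add hε, hG.smoothing_smul hε, hG.smoothing_sub hε, smul_sub]
    abel
  have e4 : c = yosida G ε b - smoothing G ε (d - c) := by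
    rw [e1, hG.yosida_add hε, hG.yosida_smul hε, e2, hG.smoothing_sub hε]
    nth_rewrite 1 [← hG.smoothing_add_yosida hε c]
    abel
  refine ⟨e3 ▸ h1, e4 ▸ h2, ?_⟩
  rw [← e3, ← e4]
  simpa using h3

/-- Resolvents of `G` map the domain of `H` into the domain of the commutator, with uniform bounds
on the commutator. -/
theorem exists_isSmoothedCommutator [CompleteSpace E] (h : IsWeaklyCommutingGraph B G H) :
    ∃ M δ : ℝ, 0 < M ∧ 0 < δ ∧ ∀ ε : ℝ, ε ≠ 0 → |ε| ≤ δ → ∀ z b, (z, b) ∈ H →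
      ∃ k, IsSmoothedCommutator G H ε z b k ∧ ‖k‖ ≤ M * (‖z‖ + ‖yosida G ε z‖ + ‖b‖) := by
  obtain ⟨κ, hκ, hbound⟩ := h.commutator_bound
  obtain ⟨𝓖, h𝓖, hcl, δ, hδ, hcore⟩ := h.core
  have hG := h.left
  have hH := h.right
  -- The commutator bound contains `‖HPz‖ ≤ ‖b‖ + |ε|‖k‖`. Once `|ε|κ ≤ 1/2`, the term in `k` is
  -- absorbed at the cost of doubling `κ`.
  refine ⟨2 * κ, min δ (1 / (2 * κ)), by positivity, by positivity, ?_⟩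
  intro ε hε hεδ
  have hε1 : |ε| ≤ δ := hεδ.trans (min_le_left _ _)
  have hε2 : |ε| * κ ≤ 1 / 2 := by
    have := hεδ.trans (min_le_right _ _)
    rw [le_div_iff₀ (by positivity)] at this
    linarith
  have bound : ∀ {z b k : E}, IsSmoothedCommutator G H ε z b k →
      ‖k‖ ≤ 2 * κ * (‖z‖ + ‖yosida G ε z‖ + ‖b‖) := by
    intro z b k hk
    have h1 := hbound (hG.mem hε z) hk.smoothing_mem hk.yosida_mem hk.mem
    rw [add_sub_cancel_left] at h1
    have h2 : ‖smoothing G ε b + (ε * I) • smoothing G ε k‖ ≤ ‖b‖ + |ε| * ‖k‖ := by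
      refine (norm_add_le _ _).trans (add_le_add (hG.norm_smoothing_le hε b) ?_)
      rw [norm_smul, norm_mul, norm_I, mul_one, norm_real, Real.norm_eq_abs]
      gcongr
      exact hG.norm_smoothing_le hε k
    have h3 := hG.norm_smoothing_le hε z
    have h4 : ‖k‖ ≤ κ * (‖z‖ + ‖yosida G ε z‖ + (‖b‖ + |ε| * ‖k‖)) := h1.trans (by gcongr)
    have h5 : |ε| * κ * ‖k‖ ≤ 1 / 2 * ‖k‖ := by gcongr
    linarith
  intro z b hz
  suffices hex : ∃ k, IsSmoothedCommutator G H ε z b k by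
    obtain ⟨k, hk⟩ := hex
    exact ⟨k, hk, bound hk⟩
  -- The a priori bound, applied to differences, makes the commutators along a core sequence Cauchy.
  -- Closedness of both graphs carries the three memberships to the limit.
  obtain ⟨w, hw𝓖, hw⟩ := mem_closure_iff_seq_limit.1 (hcl hz)
  have hk : ∀ n, ∃ k, IsSmoothedCommutator G H ε (w n).1 (w n).2 k := by
    intro n
    obtain ⟨b', c, d, h1, h2, h3⟩ := hcore ε hε hε1 (w n) (hw𝓖 n)
    exact ⟨d - c, isSmoothedCommutator_of_mem hG hH hε (h𝓖 (hw𝓖 n)) h1 h2 h3⟩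
  choose k hk using hk
  -- The three summands bound `z`, `σ_ε z` and `b`; the middle one uses `‖σ_ε‖ ≤ |ε|⁻¹`, which is
  -- harmless as `ε` is fixed here.
  have hC : 0 < 2 * κ * (1 + |ε|⁻¹ + 1) := by positivity
  have hkc : CauchySeq k := by
    have hwc := hw.cauchySeq
    rw [Metric.cauchySeq_iff] at hwc ⊢
    intro r hr
    obtain ⟨N, hN⟩ := hwc (r / (2 * κ * (1 + |ε|⁻¹ + 1))) (by positivity)
    refine ⟨N, fun m hm n hn => ?_⟩
    have h1 := hN m hm n hn
    rw [lt_div_iff₀' hC] at h1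
    refine lt_of_le_of_lt ?_ h1
    rw [dist_eq_norm, dist_eq_norm]
    refine (bound ((hk m).sub hG hε (hk n))).trans ?_
    rw [mul_assoc (2 * κ)]
    gcongr 2 * κ * ?_
    have h2 : ‖(w m).1 - (w n).1‖ ≤ ‖w m - w n‖ := norm_fst_le (w m - w n)
    have h3 : ‖(w m).2 - (w n).2‖ ≤ ‖w m - w n‖ := norm_snd_le (w m - w n)
    have h4 := hG.norm_yosida_le' hε ((w m).1 - (w n).1)
    have h5 : |ε|⁻¹ * ‖(w m).1 - (w n).1‖ ≤ |ε|⁻¹ * ‖w m - w n‖ := by gcongr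
    rw [add_mul, add_mul]
    linarith
  obtain ⟨l, hl⟩ := cauchySeq_tendsto_of_complete hkc
  have hw1 : Tendsto (fun n => (w n).1) atTop (𝓝 z) := (continuous_fst.tendsto _).comp hw
  have hw2 : Tendsto (fun n => (w n).2) atTop (𝓝 b) := (continuous_snd.tendsto _).comp hw
  have cP := hG.continuous_smoothing hε
  have cY := hG.continuous_yosida hε
  have p1 := (cP.tendsto _).comp hw1
  have p2 := (cP.tendsto _).comp hw2
  have p3 := (cP.tendsto _).comp hl
  have y1 := (cY.tendsto _).comp hw1
  have y2 := (cY.tendsto _).comp hw2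
  exact ⟨l, hH.isClosed.mem_of_tendsto (p1.prodMk_nhds (p2.add (p3.const_smul (ε * I : ℂ))))
      (.of_forall fun n => (hk n).smoothing_mem),
    hH.isClosed.mem_of_tendsto (y1.prodMk_nhds (y2.sub p3)) (.of_forall fun n => (hk n).yosida_mem),
    hG.isClosed.mem_of_tendsto ((p2.add (p3.const_smul (ε * I : ℂ))).prodMk_nhds
      ((y2.sub p3).add hl)) (.of_forall fun n => (hk n).mem)⟩

end IsWeaklyCommutingGraph

end Commutator

/-! ### The regularized first order system. -/

section FirstOrder

variable {B : Type*} {E : Type*} [NonUnitalCStarAlgebra B] [PartialOrder B] [StarOrderedRing B]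
  [NormedAddCommGroup E] [NormedSpace ℂ E] [SMul B E] [CStarModule B E]

theorem IsSelfAdjointGraph.exists_add_imaginary_smul {G : Submodule ℂ (E × E)}
    (hG : IsSelfAdjointGraph B G) {μ : ℝ} (hμ : μ ≠ 0) (f : E) :
    ∃ p a, (p, a) ∈ G ∧ a + (μ * I) • p = f := by
  have hμI : (μ * I : ℂ) ≠ 0 := mul_ne_zero (ofReal_ne_zero.2 hμ) I_ne_zero
  -- Division by `μ i`, since `(μ i)⁻¹ = -μ⁻¹ i`.
  obtain ⟨p, a, h, h'⟩ := hG.surj (-μ⁻¹) (by simpa using hμ) ((μ * I : ℂ)⁻¹ • f)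
  refine ⟨p, a, h, ?_⟩
  have h1 := congrArg ((μ * I : ℂ) • ·) h'
  have e : (μ * I : ℂ) * (((-μ⁻¹ : ℝ) : ℂ) * I) = 1 := by
    have : (μ : ℂ) ≠ 0 := ofReal_ne_zero.2 hμ
    push_cast
    linear_combination (-1 : ℂ) * I_mul_I + (-I * I) * (mul_inv_cancel₀ this)
  simp only [smul_add, smul_smul, e, one_smul, mul_inv_cancel₀ hμI] at h1
  rw [← h1, add_comm]

namespace IsWeaklyCommutingGraph

variable {G H : Submodule ℂ (E × E)}

/-- The symmetry of the matrix `[[T, s σ'], [s σ, -T]]`, where `σ` is the Yosida approximation of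
`G` and `T` has graph `H`. -/
theorem inner_yosida_matrix (hG : IsSelfAdjointGraph B G) (hH : IsSelfAdjointGraph B H)
    {ε : ℝ} (hε : ε ≠ 0) (s : ℝ) {u v a b : E} (hu : (u, a) ∈ H) (hv : (v, b) ∈ H) :
    inner B (a + (s : ℂ) • yosida G (-ε) v) u + inner B ((s : ℂ) • yosida G ε u - b) v =
      inner B u (a + (s : ℂ) • yosida G (-ε) v) + inner B v ((s : ℂ) • yosida G ε u - b) := by
  have h1 := hH.symm hu hu
  have h2 := hH.symm hv hv
  have h3 := hG.inner_yosida_left hε u v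
  have h4 := hG.inner_yosida_left (neg_ne_zero.2 hε) v u
  rw [neg_neg] at h4
  simp only [CStarModule.inner_add_left, CStarModule.inner_add_right, CStarModule.inner_sub_left,
    CStarModule.inner_sub_right, CStarModule.inner_smul_left_complex,
    CStarModule.inner_smul_right_complex, RCLike.star_def, conj_ofReal, h1, h2, h3, h4]
  abel

/-- The matrix `[[T, s σ'], [s σ, -T]]` shifted by `i μ` is bounded below by `|μ|`. -/
theorem norm_le_yosida_matrix (hG : IsSelfAdjointGraph B G) (hH : IsSelfAdjointGraph B H)
    {ε : ℝ} (hε : ε ≠ 0) (s μ : ℝ) {u v a b : E} (hu : (u, a) ∈ H) (hv : (v, b) ∈ H) :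
    |μ| * ‖u‖ ≤ ‖a + (s : ℂ) • yosida G (-ε) v + (μ * I) • u‖
        + ‖(s : ℂ) • yosida G ε u - b + (μ * I) • v‖ ∧
      |μ| * ‖v‖ ≤ ‖a + (s : ℂ) • yosida G (-ε) v + (μ * I) • u‖
        + ‖(s : ℂ) • yosida G ε u - b + (μ * I) • v‖ := by
  have key := inner_add_imaginary_smul B μ (inner_yosida_matrix hG hH hε s hu hv)
  set y₁ := a + (s : ℂ) • yosida G (-ε) v + (μ * I) • u
  set y₂ := (s : ℂ) • yosida G ε u - b + (μ * I) • v
  have hy : ‖inner B y₁ y₁ + inner B y₂ y₂‖ ≤ (‖y₁‖ + ‖y₂‖) ^ 2 := by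
    refine (norm_add_le _ _).trans ?_
    rw [← CStarModule.norm_sq_eq B, ← CStarModule.norm_sq_eq B]
    nlinarith [norm_nonneg y₁, norm_nonneg y₂]
  have nn : ∀ x : E, 0 ≤ inner B x x := fun x => CStarModule.inner_self_nonneg
  have habs : ∀ x : E, |μ| * ‖x‖ = ‖(μ : ℂ) • x‖ := fun x => by
    rw [norm_smul, norm_real, Real.norm_eq_abs]
  rw [key] at hy
  rw [habs, habs]
  constructor
  · refine le_of_sq_le_sq ((norm_sq_le_norm_of_inner_le B ?_).trans hy) (by positivity)
    exact le_add_of_le_of_nonneg (le_add_of_nonneg_left (add_nonneg (nn _) (nn _))) (nn _)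
  · refine le_of_sq_le_sq ((norm_sq_le_norm_of_inner_le B ?_).trans hy) (by positivity)
    exact le_add_of_nonneg_left (add_nonneg (add_nonneg (nn _) (nn _)) (nn _))

/-- Solvability of the regularized first order system. -/
theorem exists_yosida_matrix_eq [CompleteSpace E] (hG : IsSelfAdjointGraph B G)
    (hH : IsSelfAdjointGraph B H) {ε : ℝ} (hε : ε ≠ 0) {μ : ℝ} (hμ : μ ≠ 0) (f g : E) :
    ∃ u v a b, (u, a) ∈ H ∧ (v, b) ∈ H ∧ a + yosida G (-ε) v + (μ * I) • u = f ∧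
      yosida G ε u - b + (μ * I) • v = g := by
  have hε' : -ε ≠ 0 := neg_ne_zero.2 hε
  let A : (H × H) →ₗ[ℂ] E × E :=
    { toFun := fun p => ((p.1 : E × E).2 + (μ * I) • (p.1 : E × E).1,
        (μ * I) • (p.2 : E × E).1 - (p.2 : E × E).2)
      map_add' := fun p q => by
        simp only [Prod.fst_add, Prod.snd_add, Submodule.coe_add, smul_add, Prod.mk_add_mk,
          Prod.mk.injEq]
        constructor <;> abel
      map_smul' := fun c p => by
        simp only [Prod.smul_fst, Prod.smul_snd, Submodule.coe_smul, smul_add, smul_sub,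
          Prod.smul_mk, RingHom.id_apply, smul_comm c] }
  let K : (H × H) →ₗ[ℂ] E × E :=
    { toFun := fun p => (yosida G (-ε) (p.2 : E × E).1, yosida G ε (p.1 : E × E).1)
      map_add' := fun p q => by
        simp [hG.yosida_add hε, hG.yosida_add hε']
      map_smul' := fun c p => by
        simp [hG.yosida_smul hε, hG.yosida_smul hε'] }
  have hA : Function.Surjective A := by
    rintro ⟨f, g⟩
    obtain ⟨u, a, hu, hu'⟩ := hH.exists_add_imaginary_smul hμ f
    obtain ⟨v, b, hv, hv'⟩ := hH.exists_add_imaginary_smul (neg_ne_zero.2 hμ) (-g)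
    refine ⟨(⟨(u, a), hu⟩, ⟨(v, b), hv⟩), Prod.ext hu' ?_⟩
    change (μ * I) • v - b = g
    rw [← neg_inj, ← hv']
    push_cast
    rw [neg_mul, neg_smul]
    abel
  -- The lower bound `|μ|` does not depend on `s`, while `‖K‖ ≤ |ε|⁻¹` may be large: hence a path
  -- from the diagonal matrix instead of one perturbation.
  have hK : ∀ s : ℝ, 0 ≤ s → s ≤ 1 → ∀ p, ‖K p‖ ≤ |ε|⁻¹ * |μ|⁻¹ * 2 * ‖A p + (s : ℂ) • K p‖ := by
    rintro s - - ⟨⟨⟨u, a⟩, hu⟩, ⟨⟨v, b⟩, hv⟩⟩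
    obtain ⟨h1, h2⟩ := norm_le_yosida_matrix hG hH hε s μ hu hv
    set r := A (⟨(u, a), hu⟩, ⟨(v, b), hv⟩) + (s : ℂ) • K (⟨(u, a), hu⟩, ⟨(v, b), hv⟩) with hr
    have r1 : r.1 = a + (s : ℂ) • yosida G (-ε) v + (μ * I) • u := by
      change (a + (μ * I) • u) + (s : ℂ) • yosida G (-ε) v = _
      abel
    have r2 : r.2 = (s : ℂ) • yosida G ε u - b + (μ * I) • v := by
      change ((μ * I) • v - b) + (s : ℂ) • yosida G ε u = _
      abel
    rw [← r1, ← r2] at h1 h2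
    have h3 := norm_fst_le r
    have h4 := norm_snd_le r
    have hμ0 : 0 < |μ| := abs_pos.2 hμ
    have h5 : ‖u‖ ≤ |μ|⁻¹ * (2 * ‖r‖) := by
      rw [inv_mul_eq_div, le_div_iff₀' hμ0]; linarith
    have h6 : ‖v‖ ≤ |μ|⁻¹ * (2 * ‖r‖) := by
      rw [inv_mul_eq_div, le_div_iff₀' hμ0]; linarith
    have e : |ε|⁻¹ * |μ|⁻¹ * 2 * ‖r‖ = |ε|⁻¹ * (|μ|⁻¹ * (2 * ‖r‖)) := by ring
    rw [e]
    refine max_le ?_ ?_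
    · have := hG.norm_yosida_le' hε' v
      rw [abs_neg] at this
      exact this.trans (by gcongr)
    · exact (hG.norm_yosida_le' hε u).trans (by gcongr)
  obtain ⟨⟨⟨⟨u, a⟩, hu⟩, ⟨⟨v, b⟩, hv⟩⟩, h⟩ := surjective_add_of_path A K hA hK (f, g)
  refine ⟨u, v, a, b, hu, hv, ?_, ?_⟩
  · refine Eq.trans ?_ (congrArg Prod.fst h)
    change _ = (a + (μ * I) • u) + yosida G (-ε) v
    abel
  · refine Eq.trans ?_ (congrArg Prod.snd h)
    change _ = ((μ * I) • v - b) + yosida G ε u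
    abel

/-- The uniform first order estimate for the regularized system. -/
theorem exists_first_order_estimate [CompleteSpace E] (h : IsWeaklyCommutingGraph B G H) :
    ∃ m δ : ℝ, 0 < m ∧ 0 < δ ∧ ∀ μ : ℝ, m ≤ |μ| → ∀ ε : ℝ, ε ≠ 0 → |ε| ≤ δ →
      ∀ {u v a b y₁ y₂ : E}, (u, a) ∈ H → (v, b) ∈ H →
        a + yosida G (-ε) v + (μ * I) • u = y₁ → yosida G ε u - b + (μ * I) • v = y₂ →
        ∀ x ∈ ({a, b, yosida G (-ε) v, yosida G ε u, (μ : ℂ) • u, (μ : ℂ) • v} : Set E),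
          ‖x‖ ≤ 2 * (‖y₁‖ + ‖y₂‖) := by
  obtain ⟨M, δ, hM, hδ, hcomm⟩ := h.exists_isSmoothedCommutator
  have hG := h.left
  have hH := h.right
  -- In `12 M` the factor 3 counts the terms bounding `k`, and the factor 4 makes each of the two
  -- commutator pairings at most `Q² / 4`.
  refine ⟨max 1 (12 * M), δ, by positivity, hδ, ?_⟩
  intro μ hμ ε hε hεδ u v a b y₁ y₂ hu hv hy₁ hy₂
  have hμ1 : 1 ≤ |μ| := (le_max_left _ _).trans hμ
  have hμ2 : 12 * M ≤ |μ| := (le_max_right _ _).trans hμ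
  obtain ⟨k, hk, hkM⟩ := hcomm ε hε hεδ u a hu
  have hsym := inner_yosida_matrix hG hH hε 1 hu hv
  simp only [ofReal_one, one_smul] at hsym
  have key := inner_add_imaginary_smul B μ hsym
  rw [hy₁, hy₂] at key
  -- The cross terms are `⟨Tu, σ_{-ε}v⟩ - ⟨σ_ε u, Tv⟩` and its adjoint. Moving everything off `v`
  -- leaves `⟨(σ_ε T - Tσ_ε)u, v⟩ = ⟨Pk, v⟩`, with `P` the smoothing operator.
  have hσ1 : inner B a (yosida G (-ε) v) = inner B (yosida G ε a) v :=
    (hG.inner_yosida_left hε a v).symm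
  have hσ2 : inner B (yosida G ε u) b = inner B (yosida G ε a) v - inner B (smoothing G ε k) v := by
    rw [← hH.symm hk.yosida_mem hv, CStarModule.inner_sub_left]
  have hσ1' : inner B (yosida G (-ε) v) a = inner B v (yosida G ε a) := by
    rw [← CStarModule.star_inner, hσ1, CStarModule.star_inner]
  have hσ2' : inner B b (yosida G ε u) = inner B v (yosida G ε a) - inner B v (smoothing G ε k) := by
    rw [← CStarModule.star_inner, hσ2, star_sub, CStarModule.star_inner, CStarModule.star_inner]
  set q : B := inner B a a + inner B b b + inner B (yosida G (-ε) v) (yosida G (-ε) v)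
    + inner B (yosida G ε u) (yosida G ε u) + inner B ((μ : ℂ) • u) ((μ : ℂ) • u)
    + inner B ((μ : ℂ) • v) ((μ : ℂ) • v) with hq
  have hqy : q = inner B y₁ y₁ + inner B y₂ y₂ - inner B (smoothing G ε k) v
      - inner B v (smoothing G ε k) := by
    rw [key, hq]
    simp only [CStarModule.inner_add_left, CStarModule.inner_add_right, CStarModule.inner_sub_left,
      CStarModule.inner_sub_right, hσ1, hσ2, hσ1', hσ2']
    abel
  have nn : ∀ x : E, 0 ≤ inner B x x := fun x => CStarModule.inner_self_nonneg
  have hle : ∀ x ∈ ({a, b, yosida G (-ε) v, yosida G ε u, (μ : ℂ) • u, (μ : ℂ) • v} : Set E),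
      ‖x‖ ^ 2 ≤ ‖q‖ := by
    intro x hx
    refine norm_sq_le_norm_of_inner_le B ?_
    have n1 := nn a
    have n2 := nn b
    have n3 := nn (yosida G (-ε) v)
    have n4 := nn (yosida G ε u)
    have n5 := nn ((μ : ℂ) • u)
    have n6 := nn ((μ : ℂ) • v)
    rw [← sub_nonneg]
    have nonneg5 : ∀ c₁ c₂ c₃ c₄ c₅ : B, 0 ≤ c₁ → 0 ≤ c₂ → 0 ≤ c₃ → 0 ≤ c₄ → 0 ≤ c₅ →
        0 ≤ c₁ + c₂ + c₃ + c₄ + c₅ := fun _ _ _ _ _ h1 h2 h3 h4 h5 =>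
      add_nonneg (add_nonneg (add_nonneg (add_nonneg h1 h2) h3) h4) h5
    rcases hx with rfl | rfl | rfl | rfl | rfl | rfl
    · refine (nonneg5 _ _ _ _ _ n2 n3 n4 n5 n6).trans_eq ?_
      rw [hq]; abel
    · refine (nonneg5 _ _ _ _ _ n1 n3 n4 n5 n6).trans_eq ?_
      rw [hq]; abel
    · refine (nonneg5 _ _ _ _ _ n1 n2 n4 n5 n6).trans_eq ?_
      rw [hq]; abel
    · refine (nonneg5 _ _ _ _ _ n1 n2 n3 n5 n6).trans_eq ?_
      rw [hq]; abel
    · refine (nonneg5 _ _ _ _ _ n1 n2 n3 n4 n6).trans_eq ?_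
      rw [hq]; abel
    · refine (nonneg5 _ _ _ _ _ n1 n2 n3 n4 n5).trans_eq ?_
      rw [hq]; abel
  set Q := Real.sqrt ‖q‖ with hQ
  have hQ0 : 0 ≤ Q := Real.sqrt_nonneg _
  have hQ2 : Q ^ 2 = ‖q‖ := Real.sq_sqrt (norm_nonneg _)
  rw [← hQ2] at hle
  have hle' : ∀ x ∈ ({a, b, yosida G (-ε) v, yosida G ε u, (μ : ℂ) • u, (μ : ℂ) • v} : Set E),
      ‖x‖ ≤ Q := fun x hx => le_of_sq_le_sq (hle x hx) hQ0
  have habs : ∀ x : E, ‖(μ : ℂ) • x‖ = |μ| * ‖x‖ := fun x => by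
    rw [norm_smul, norm_real, Real.norm_eq_abs]
  have hu' : |μ| * ‖u‖ ≤ Q := habs u ▸ hle' _ (by simp)
  have hv' : |μ| * ‖v‖ ≤ Q := habs v ▸ hle' _ (by simp)
  have hu1 : ‖u‖ ≤ Q := by nlinarith [norm_nonneg u]
  have hk' : ‖k‖ ≤ M * (Q + Q + Q) :=
    hkM.trans (by gcongr; exacts [hle' _ (by simp), hle' _ (by simp)])
  have hkv : ‖smoothing G ε k‖ * ‖v‖ ≤ Q ^ 2 / 4 := by
    have h1 := hG.norm_smoothing_le hε k
    calc ‖smoothing G ε k‖ * ‖v‖ ≤ M * (Q + Q + Q) * ‖v‖ := by gcongr; exact h1.trans hk'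
      _ = (12 * M * ‖v‖) * Q / 4 := by ring
      _ ≤ (|μ| * ‖v‖) * Q / 4 := by gcongr
      _ ≤ Q * Q / 4 := by gcongr
      _ = Q ^ 2 / 4 := by ring
  -- Absorption: `Q² ≤ ‖y₁‖² + ‖y₂‖² + Q² / 2`.
  have hfin : Q ^ 2 ≤ (2 * (‖y₁‖ + ‖y₂‖)) ^ 2 := by
    have h1 : ‖q‖ ≤ ‖y₁‖ ^ 2 + ‖y₂‖ ^ 2 + ‖smoothing G ε k‖ * ‖v‖ + ‖v‖ * ‖smoothing G ε k‖ := by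
      rw [hqy]
      refine (norm_sub_le _ _).trans (add_le_add ((norm_sub_le _ _).trans (add_le_add
        ((norm_add_le _ _).trans_eq ?_) (CStarModule.norm_inner_le E)))
        (CStarModule.norm_inner_le E))
      rw [← CStarModule.norm_sq_eq B, ← CStarModule.norm_sq_eq B]
    rw [← hQ2, mul_comm ‖v‖] at h1
    nlinarith [norm_nonneg y₁, norm_nonneg y₂]
  intro x hx
  exact (hle' x hx).trans (le_of_sq_le_sq hfin (by positivity))

end IsWeaklyCommutingGraph

end FirstOrder

/-! ### Surjectivity of the first order system. -/

section System

variable {B : Type*} {E : Type*} [NonUnitalCStarAlgebra B] [PartialOrder B] [StarOrderedRing B]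
  [NormedAddCommGroup E] [NormedSpace ℂ E] [SMul B E] [CStarModule B E]

namespace IsSelfAdjointGraph

variable {G : Submodule ℂ (E × E)} (hG : IsSelfAdjointGraph B G) {ε : ℝ}
include hG

theorem tendsto_yosida_neg {x a : E} (h : (x, a) ∈ G) :
    Tendsto (fun ε => yosida G (-ε) x) (𝓝[≠] 0) (𝓝 a) := by
  refine (hG.tendsto_yosida h).comp (tendsto_nhdsWithin_iff.2 ⟨?_, ?_⟩)
  · simpa using (continuous_neg.tendsto (0 : ℝ)).mono_left nhdsWithin_le_nhds
  · filter_upwards [self_mem_nhdsWithin] with ε hε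
    exact neg_ne_zero.2 hε

/-- The operator `σ_ε` is normal with adjoint `σ_{-ε}`. The first order estimate controls `σ_{-ε}
v`, whereas the commutator bound asks for `σ_ε v`. -/
theorem norm_yosida_neg (hε : ε ≠ 0) (x : E) : ‖yosida G (-ε) x‖ = ‖yosida G ε x‖ := by
  have hε' : -ε ≠ 0 := neg_ne_zero.2 hε
  have h1 := hG.inner_yosida_left hε x (yosida G ε x)
  have h2 := hG.inner_yosida_left hε' x (yosida G (-ε) x)
  rw [neg_neg, hG.yosida_comm hε' hε, ← h1] at h2
  rw [CStarModule.norm_eq_sqrt_norm_inner_self (A := B), h2,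
    ← CStarModule.norm_eq_sqrt_norm_inner_self]

end IsSelfAdjointGraph

/-- All triples `(x, a, b)` with `(x, a) ∈ G` and `(x, b) ∈ H`. -/
def jointGraph (G H : Submodule ℂ (E × E)) : Submodule ℂ (E × E × E) :=
  G.comap ((LinearMap.fst ℂ E (E × E)).prod (LinearMap.fst ℂ E E ∘ₗ LinearMap.snd ℂ E (E × E))) ⊓
    H.comap ((LinearMap.fst ℂ E (E × E)).prod (LinearMap.snd ℂ E E ∘ₗ LinearMap.snd ℂ E (E × E)))

theorem mem_jointGraph {G H : Submodule ℂ (E × E)} {p : E × E × E} :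
    p ∈ jointGraph G H ↔ (p.1, p.2.1) ∈ G ∧ (p.1, p.2.2) ∈ H := Iff.rfl

theorem isClosed_jointGraph {G H : Submodule ℂ (E × E)} (hG : IsClosed (G : Set (E × E)))
    (hH : IsClosed (H : Set (E × E))) : IsClosed (jointGraph G H : Set (E × E × E)) :=
  (hG.preimage (f := fun p : E × E × E => (p.1, p.2.1)) (by fun_prop)).inter
    (hH.preimage (f := fun p : E × E × E => (p.1, p.2.2)) (by fun_prop))

namespace IsWeaklyCommutingGraph

variable {G H : Submodule ℂ (E × E)}

/-- The first order operator `[[T, S], [S, -T]] + i μ`. -/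
noncomputable def firstOrder (G H : Submodule ℂ (E × E)) (μ : ℝ) :
    (jointGraph G H × jointGraph G H) →ₗ[ℂ] E × E where
  toFun p := ((p.1 : E × E × E).2.2 + (p.2 : E × E × E).2.1 + (μ * I) • (p.1 : E × E × E).1,
    (p.1 : E × E × E).2.1 - (p.2 : E × E × E).2.2 + (μ * I) • (p.2 : E × E × E).1)
  map_add' p q := by
    simp only [Prod.fst_add, Prod.snd_add, Submodule.coe_add, smul_add, Prod.mk_add_mk,
      Prod.mk.injEq]
    constructor <;> abel
  map_smul' c p := by
    simp only [Prod.smul_fst, Prod.smul_snd, Submodule.coe_smul, smul_add, smul_sub,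
      Prod.smul_mk, RingHom.id_apply, smul_comm c]

theorem continuous_firstOrder (μ : ℝ) : Continuous (firstOrder G H μ) := by
  change Continuous fun p : jointGraph G H × jointGraph G H =>
    ((p.1 : E × E × E).2.2 + (p.2 : E × E × E).2.1 + (μ * I) • (p.1 : E × E × E).1,
    (p.1 : E × E × E).2.1 - (p.2 : E × E × E).2.2 + (μ * I) • (p.2 : E × E × E).1)
  fun_prop

/-- The first order operator is bounded below in the graph norm. -/
theorem exists_norm_le_firstOrder [CompleteSpace E] (h : IsWeaklyCommutingGraph B G H) :
    ∃ m : ℝ, 0 < m ∧ ∀ μ : ℝ, m ≤ |μ| → ∀ p, ‖p‖ ≤ 4 * ‖firstOrder G H μ p‖ := by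
  obtain ⟨m, δ, hm, hδ, hest⟩ := h.exists_first_order_estimate
  have hG := h.left
  refine ⟨max m 1, by positivity, ?_⟩
  rintro μ hμ ⟨⟨⟨u, a, b⟩, hu⟩, ⟨⟨v, a', b'⟩, hv⟩⟩
  have hμ1 : 1 ≤ |μ| := (le_max_right _ _).trans hμ
  rw [mem_jointGraph] at hu hv
  simp only at hu hv
  set r := firstOrder G H μ (⟨(u, a, b), hu⟩, ⟨(v, a', b'), hv⟩) with hr
  have r1 : r.1 = b + a' + (μ * I) • u := rfl
  have r2 : r.2 = a - b' + (μ * I) • v := rfl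
  have hr3 : 2 * (‖r.1‖ + ‖r.2‖) ≤ 4 * ‖r‖ := by
    linarith [norm_fst_le r, norm_snd_le r]
  have t1 : Tendsto (fun ε => b + yosida G (-ε) v + (μ * I) • u) (𝓝[≠] 0) (𝓝 r.1) :=
    r1 ▸ (((hG.tendsto_yosida_neg hv.1).const_add b).add_const _)
  have t2 : Tendsto (fun ε => yosida G ε u - b' + (μ * I) • v) (𝓝[≠] 0) (𝓝 r.2) :=
    r2 ▸ (((hG.tendsto_yosida hu.1).sub_const b').add_const _)
  have t3 := (t1.norm.add t2.norm).const_mul 2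
  have hev : ∀ᶠ ε : ℝ in 𝓝[≠] 0, ε ≠ 0 ∧ |ε| ≤ δ := by
    refine (eventually_mem_nhdsWithin).and ?_
    have : Tendsto (fun ε : ℝ => |ε|) (𝓝[≠] 0) (𝓝 0) := by
      simpa using (continuous_abs.tendsto (0 : ℝ)).mono_left nhdsWithin_le_nhds
    exact (this.eventually (gt_mem_nhds hδ)).mono fun _ => le_of_lt
  have hest' := fun (ε : ℝ) (hε : ε ≠ 0 ∧ |ε| ≤ δ) =>
    hest μ ((le_max_left _ _).trans hμ) ε hε.1 hε.2 hu.2 hv.2 rfl rfl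
  -- The regularized estimate is uniform in `ε`, and `σ_{±ε}` converges to `G` on its domain, so the
  -- estimate survives as `ε → 0`.
  have lim : ∀ {F : ℝ → E} {x : E}, Tendsto F (𝓝[≠] 0) (𝓝 x) →
      (∀ ε : ℝ, F ε ∈ ({b, b', yosida G (-ε) v, yosida G ε u, (μ : ℂ) • u, (μ : ℂ) • v} : Set E)) →
      ‖x‖ ≤ 4 * ‖r‖ := fun hF hmem =>
    (le_of_tendsto_of_tendsto hF.norm t3
      (hev.mono fun ε hε => hest' ε hε _ (hmem ε))).trans hr3
  have habs : ∀ x : E, ‖x‖ ≤ ‖(μ : ℂ) • x‖ := fun x => by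
    rw [norm_smul, norm_real, Real.norm_eq_abs]
    exact le_mul_of_one_le_left (norm_nonneg _) hμ1
  refine max_le (max_le ?_ (max_le ?_ ?_)) (max_le ?_ (max_le ?_ ?_))
  · exact (habs u).trans (lim tendsto_const_nhds fun _ => by simp)
  · exact lim (hG.tendsto_yosida hu.1) fun _ => by simp
  · exact lim (tendsto_const_nhds (x := b)) fun _ => by simp
  · exact (habs v).trans (lim tendsto_const_nhds fun _ => by simp)
  · exact lim (hG.tendsto_yosida_neg hv.1) fun _ => by simp
  · exact lim (tendsto_const_nhds (x := b')) fun _ => by simp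

/-- The smoothed solutions of the regularized system are approximate solutions of the first order
system. -/
theorem exists_approx_firstOrder [CompleteSpace E] (h : IsWeaklyCommutingGraph B G H) :
    ∃ m δ : ℝ, 0 < m ∧ 0 < δ ∧ ∀ μ : ℝ, m ≤ |μ| → ∀ {f g f' g' : E}, (f, f') ∈ G → (g, g') ∈ G →
      ∃ C : ℝ, ∀ ε : ℝ, ε ≠ 0 → |ε| ≤ δ →
        ∃ p, ‖firstOrder G H μ p - (smoothing G ε f, smoothing G ε g)‖ ≤ |ε| * C := by
  obtain ⟨m, δ₁, hm, hδ₁, hest⟩ := h.exists_first_order_estimate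
  obtain ⟨M, δ₂, hM, hδ₂, hcomm⟩ := h.exists_isSmoothedCommutator
  have hG := h.left
  have hH := h.right
  refine ⟨max m 1, min δ₁ δ₂, by positivity, by positivity, ?_⟩
  intro μ hμ f g f' g' hf hg
  have hμ1 : 1 ≤ |μ| := (le_max_right _ _).trans hμ
  have hμm : m ≤ |μ| := (le_max_left _ _).trans hμ
  have hμ0 : μ ≠ 0 := abs_pos.1 (by linarith)
  -- `N` is the bound of the first estimate with data `f, g`; `N'` is that of the second, whose data
  -- involve `f'`, `g'` and two commutators.
  set N := 2 * (‖f‖ + ‖g‖) with hN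
  set N' := 2 * ((‖f'‖ + M * (N + N + N)) + (‖g'‖ + M * (N + N + N))) with hN'
  refine ⟨M * (N + N + N) + N', fun ε hε hεδ => ?_⟩
  have hε1 : |ε| ≤ δ₁ := hεδ.trans (min_le_left _ _)
  have hε2 : |ε| ≤ δ₂ := hεδ.trans (min_le_right _ _)
  have hε' : -ε ≠ 0 := neg_ne_zero.2 hε
  obtain ⟨u, v, a, b, hu, hv, hf', hg'⟩ := exists_yosida_matrix_eq hG hH hε hμ0 f g
  have hle := hest μ hμm ε hε hε1 hu hv hf' hg'
  have habs : ∀ x : E, ‖x‖ ≤ ‖(μ : ℂ) • x‖ := fun x => by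
    rw [norm_smul, norm_real, Real.norm_eq_abs]
    exact le_mul_of_one_le_left (norm_nonneg _) hμ1
  obtain ⟨k, hk, hkM⟩ := hcomm ε hε hε2 u a hu
  obtain ⟨l, hl, hlM⟩ := hcomm ε hε hε2 v b hv
  have hkN : ‖k‖ ≤ M * (N + N + N) := hkM.trans (by
    gcongr
    exacts [(habs u).trans (hle _ (by simp)), hle _ (by simp), hle _ (by simp)])
  have hlN : ‖l‖ ≤ M * (N + N + N) := hlM.trans (by
    rw [← hG.norm_yosida_neg hε]
    gcongr
    exacts [(habs v).trans (hle _ (by simp)), hle _ (by simp), hle _ (by simp)])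
  -- Applying `σ_ε` to both equations shows that `(σ_ε u, σ_ε v)` solves the same system with
  -- bounded data, because `f, g ∈ D(G)`. This bounds `σ_{-ε}σ_ε v` and `σ_ε σ_ε u` uniformly in
  -- `ε`.
  have e1 : yosida G ε a - smoothing G ε k + yosida G (-ε) (yosida G ε v) + (μ * I) • yosida G ε u
      = smoothing G ε f' - smoothing G ε k := by
    rw [← (hG.smoothing_mem hε hf).2, ← hf', hG.yosida_add hε, hG.yosida_add hε,
      hG.yosida_smul hε, hG.yosida_comm hε hε']
    abel
  have e2 : yosida G ε (yosida G ε u) - (yosida G ε b - smoothing G ε l) + (μ * I) • yosida G ε v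
      = smoothing G ε g' + smoothing G ε l := by
    rw [← (hG.smoothing_mem hε hg).2, ← hg', hG.yosida_add hε, hG.yosida_sub hε,
      hG.yosida_smul hε]
    abel
  have hle2 := hest μ hμm ε hε hε1 hk.yosida_mem hl.yosida_mem e1 e2
  have hN2 : 2 * (‖smoothing G ε f' - smoothing G ε k‖ + ‖smoothing G ε g' + smoothing G ε l‖)
      ≤ N' := by
    rw [hN']
    gcongr
    · exact (norm_sub_le _ _).trans (add_le_add (hG.norm_smoothing_le hε _)
        ((hG.norm_smoothing_le hε _).trans hkN))
    · exact (norm_add_le _ _).trans (add_le_add (hG.norm_smoothing_le hε _)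
        ((hG.norm_smoothing_le hε _).trans hlN))
  -- The approximate solution is the smoothed one, `(Pu, Pv)`. Subtracting `P` applied to the
  -- regularized equations leaves only terms with a factor `iε`.
  refine ⟨(⟨(smoothing G ε u, yosida G ε u, _), hG.mem hε u, hk.smoothing_mem⟩,
    ⟨(smoothing G ε v, yosida G ε v, _), hG.mem hε v, hl.smoothing_mem⟩), ?_⟩
  have hnorm : ∀ x : E, ‖(ε * I : ℂ) • x‖ = |ε| * ‖x‖ := fun x => by
    rw [norm_smul, norm_mul, norm_I, mul_one, norm_real, Real.norm_eq_abs]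
  refine max_le ?_ ?_
  · change ‖(smoothing G ε a + (ε * I) • smoothing G ε k) + yosida G ε v
      + (μ * I) • smoothing G ε u - smoothing G ε f‖ ≤ _
    have e : (smoothing G ε a + (ε * I : ℂ) • smoothing G ε k) + yosida G ε v
        + (μ * I : ℂ) • smoothing G ε u - smoothing G ε f
        = (ε * I : ℂ) • (smoothing G ε k - yosida G (-ε) (yosida G ε v)) := by
      rw [hG.yosida_comm hε hε' v, ← hf', hG.smoothing_add hε, hG.smoothing_add hε,
        hG.smoothing_smul hε, hG.yosida_eq hε v, smul_sub]
      abel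
    rw [e, hnorm]
    gcongr
    exact (norm_sub_le _ _).trans (add_le_add ((hG.norm_smoothing_le hε _).trans hkN)
      ((hle2 _ (by simp)).trans hN2))
  · change ‖yosida G ε u - (smoothing G ε b + (ε * I) • smoothing G ε l)
      + (μ * I) • smoothing G ε v - smoothing G ε g‖ ≤ _
    have e : yosida G ε u - (smoothing G ε b + (ε * I : ℂ) • smoothing G ε l)
        + (μ * I : ℂ) • smoothing G ε v - smoothing G ε g
        = (ε * I : ℂ) • (yosida G ε (yosida G ε u) - smoothing G ε l) := by
      rw [← hg', hG.smoothing_add hε, hG.smoothing_sub hε, hG.smoothing_smul hε, smul_sub]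
      nth_rewrite 1 [← hG.smoothing_add_yosida hε (yosida G ε u)]
      abel
    rw [e, hnorm]
    gcongr
    rw [add_comm (M * _)]
    exact (norm_sub_le _ _).trans (add_le_add ((hle2 _ (by simp)).trans hN2)
      ((hG.norm_smoothing_le hε _).trans hlN))

theorem exists_surjective_firstOrder [CompleteSpace E] (h : IsWeaklyCommutingGraph B G H) :
    ∃ m : ℝ, 0 < m ∧ ∀ μ : ℝ, m ≤ |μ| → Function.Surjective (firstOrder G H μ) := by
  obtain ⟨m₁, hm₁, hbd⟩ := h.exists_norm_le_firstOrder
  obtain ⟨m₂, δ, hm₂, hδ, happ⟩ := h.exists_approx_firstOrder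
  have hG := h.left
  refine ⟨max m₁ m₂, by positivity, fun μ hμ => ?_⟩
  have : CompleteSpace (jointGraph G H) :=
    (isClosed_jointGraph hG.isClosed h.right.isClosed).completeSpace_coe
  have hanti : AntilipschitzWith 4 (firstOrder G H μ) :=
    AddMonoidHomClass.antilipschitz_of_bound _ fun p => by
      simpa using hbd μ ((le_max_left _ _).trans hμ) p
  let Φ : (jointGraph G H × jointGraph G H) →L[ℂ] E × E :=
    ⟨firstOrder G H μ, continuous_firstOrder μ⟩
  -- Being bounded below in the complete joint graph norm closes the range; the approximate
  -- solutions for `f, g ∈ D(G)` make it dense.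
  have hcl : IsClosed (Set.range (firstOrder G H μ)) :=
    hanti.isClosed_range Φ.uniformContinuous
  have hdense : DenseRange (firstOrder G H μ) := by
    have hD := hG.dense.prod hG.dense
    rw [DenseRange, ← dense_closure]
    refine hD.mono ?_
    rintro ⟨f, g⟩ ⟨⟨f', hf⟩, ⟨g', hg⟩⟩
    obtain ⟨C, hC⟩ := happ μ ((le_max_right _ _).trans hμ) hf hg
    have hev : ∀ᶠ ε : ℝ in 𝓝[≠] 0, ε ≠ 0 ∧ |ε| ≤ δ := by
      refine (eventually_mem_nhdsWithin).and ?_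
      have : Tendsto (fun ε : ℝ => |ε|) (𝓝[≠] 0) (𝓝 0) := by
        simpa using (continuous_abs.tendsto (0 : ℝ)).mono_left nhdsWithin_le_nhds
      exact (this.eventually (gt_mem_nhds hδ)).mono fun _ => le_of_lt
    have hC' : ∀ ε : ℝ, ∃ p, ε ≠ 0 ∧ |ε| ≤ δ →
        ‖firstOrder G H μ p - (smoothing G ε f, smoothing G ε g)‖ ≤ |ε| * C := by
      intro ε
      by_cases hε : ε ≠ 0 ∧ |ε| ≤ δ
      · obtain ⟨p, hp⟩ := hC ε hε.1 hε.2
        exact ⟨p, fun _ => hp⟩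
      · exact ⟨0, fun h => absurd h hε⟩
    choose p hp using hC'
    have t0 : Tendsto (fun ε : ℝ => |ε| * C) (𝓝[≠] 0) (𝓝 0) := by
      have : Continuous fun ε : ℝ => |ε| * C := by fun_prop
      simpa using (this.tendsto 0).mono_left nhdsWithin_le_nhds
    have t1 : Tendsto (fun ε => firstOrder G H μ (p ε) - (smoothing G ε f, smoothing G ε g))
        (𝓝[≠] 0) (𝓝 0) := squeeze_zero_norm' (hev.mono hp) t0
    have t2 := t1.add ((hG.tendsto_smoothing f).prodMk_nhds (hG.tendsto_smoothing g))
    simp only [sub_add_cancel, zero_add] at t2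
    exact mem_closure_of_tendsto t2 (.of_forall fun ε => Set.mem_range_self _)
  rw [← Set.range_eq_univ, ← hcl.closure_eq, hdense.closure_eq]

end IsWeaklyCommutingGraph

end System

/-! ### The operators `G ± iH`: adjoints and second order regularity. -/

section Sum

variable {B : Type*} {E : Type*} [NonUnitalCStarAlgebra B] [PartialOrder B] [StarOrderedRing B]
  [NormedAddCommGroup E] [NormedSpace ℂ E] [SMul B E] [CStarModule B E]

/-- The operator `G + ζ H`. -/
noncomputable def addSMul (G H : Submodule ℂ (E × E)) (ζ : ℂ) : jointGraph G H →ₗ[ℂ] E where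
  toFun p := (p : E × E × E).2.1 + ζ • (p : E × E × E).2.2
  map_add' p q := by simp only [Submodule.coe_add, Prod.snd_add, Prod.fst_add, smul_add]; abel
  map_smul' c p := by
    simp only [Submodule.coe_smul, Prod.smul_snd, Prod.smul_fst, smul_add, RingHom.id_apply,
      smul_comm c]

theorem addSMul_apply {G H : Submodule ℂ (E × E)} (ζ : ℂ) (p : jointGraph G H) :
    addSMul G H ζ p = (p : E × E × E).2.1 + ζ • (p : E × E × E).2.2 := rfl

/-- Elements `x` in the domains of all products of two of the operators with graphs `G` and `H`:
triples of `(x, G x, H x)`, `(G x, G² x, H G x)` and `(H x, G H x, H² x)`. -/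
def secondOrderGraph (G H : Submodule ℂ (E × E)) :
    Submodule ℂ (jointGraph G H × jointGraph G H × jointGraph G H) where
  carrier := {p | (p.2.1 : E × E × E).1 = (p.1 : E × E × E).2.1 ∧
    (p.2.2 : E × E × E).1 = (p.1 : E × E × E).2.2}
  zero_mem' := by simp
  add_mem' := by
    rintro p q ⟨h1, h2⟩ ⟨h3, h4⟩
    exact ⟨congrArg₂ (· + ·) h1 h3, congrArg₂ (· + ·) h2 h4⟩
  smul_mem' := by
    rintro c p ⟨h1, h2⟩
    exact ⟨congrArg (c • ·) h1, congrArg (c • ·) h2⟩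

theorem inner_addSMul_left {G H : Submodule ℂ (E × E)} (hG : IsSelfAdjointGraph B G)
    (hH : IsSelfAdjointGraph B H) {ζ : ℂ} (hζ : star ζ = -ζ) (p q : jointGraph G H) :
    inner B (addSMul G H ζ p) (q : E × E × E).1 =
      inner B (p : E × E × E).1 (addSMul G H (-ζ) q) := by
  obtain ⟨p1, p2⟩ := mem_jointGraph.1 p.2
  obtain ⟨q1, q2⟩ := mem_jointGraph.1 q.2
  rw [addSMul_apply, addSMul_apply, CStarModule.inner_add_left, CStarModule.inner_add_right,
    CStarModule.inner_smul_left_complex, CStarModule.inner_smul_right_complex, hζ,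
    hG.symm p1 q1, hH.symm p2 q2]

namespace IsWeaklyCommutingGraph

variable {G H : Submodule ℂ (E × E)}

/-- The first order system for `G + ζ H` and `G - ζ H`, where `ζ = ± i`. -/
theorem exists_addSMul_system [CompleteSpace E] (h : IsWeaklyCommutingGraph B G H) :
    ∃ m : ℝ, 0 < m ∧ ∀ μ : ℝ, m ≤ |μ| → ∀ ζ : ℂ, ζ = I ∨ ζ = -I → ∀ f g : E,
      ∃ p q : jointGraph G H,
        addSMul G H (-ζ) q + (μ : ℂ) • (p : E × E × E).1 = f ∧
        addSMul G H ζ p - (μ : ℂ) • (q : E × E × E).1 = g := by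
  obtain ⟨m, hm, hsurj⟩ := h.exists_surjective_firstOrder
  have key : ∀ μ : ℝ, m ≤ |μ| → ∀ f g : E, ∃ p q : jointGraph G H,
      addSMul G H (-I) q + (μ : ℂ) • (p : E × E × E).1 = f ∧
        addSMul G H I p - (μ : ℂ) • (q : E × E × E).1 = g := by
    intro μ hμ f g
    -- With `p = u + iv` and `q = u - iv`, the second row minus and plus `i` times the first row are
    -- the two equations sought. The data are chosen to give `f` and `g`.
    obtain ⟨⟨u, v⟩, huv⟩ := hsurj μ hμ ((-I / 2) • (g - f), (1 / 2 : ℂ) • (f + g))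
    obtain ⟨⟨u, a, b⟩, hu⟩ := u
    obtain ⟨⟨v, a', b'⟩, hv⟩ := v
    have h1 : b + a' + (μ * I : ℂ) • u = (-I / 2 : ℂ) • (g - f) := congrArg Prod.fst huv
    have h2 : a - b' + (μ * I : ℂ) • v = (1 / 2 : ℂ) • (f + g) := congrArg Prod.snd huv
    refine ⟨⟨(u, a, b), hu⟩ + I • ⟨(v, a', b'), hv⟩, ⟨(u, a, b), hu⟩ - I • ⟨(v, a', b'), hv⟩,
      ?_, ?_⟩
    · have e : f = (1 / 2 : ℂ) • (f + g) - I • ((-I / 2 : ℂ) • (g - f)) := by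
        match_scalars <;> (ring_nf; try (rw [I_sq]; try ring))
      rw [e, ← h1, ← h2]
      change (a - I • a') + (-I) • (b - I • b') + (μ : ℂ) • (u + I • v) = _
      match_scalars <;> (ring_nf; try (rw [I_sq]; try ring))
    · have e : g = (1 / 2 : ℂ) • (f + g) + I • ((-I / 2 : ℂ) • (g - f)) := by
        match_scalars <;> (ring_nf; try (rw [I_sq]; try ring))
      rw [e, ← h1, ← h2]
      change (a + I • a') + I • (b + I • b') - (μ : ℂ) • (u - I • v) = _
      match_scalars <;> (ring_nf; try (rw [I_sq]; try ring))
  refine ⟨m, hm, ?_⟩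
  rintro μ hμ ζ (rfl | rfl) f g
  · exact key μ hμ f g
  -- Passing from `i` to `-i` exchanges `p` with `q`, `f` with `g`, and the sign of `μ`.
  · obtain ⟨p, q, h1, h2⟩ := key (-μ) (by rwa [abs_neg]) g f
    refine ⟨q, p, ?_, ?_⟩
    · rw [← h2]; simp
    · rw [← h1]; simp [sub_eq_add_neg]

/-- The adjoint of `G + ζ H` is `G - ζ H`. -/
theorem exists_of_inner_addSMul_eq [CompleteSpace E] (h : IsWeaklyCommutingGraph B G H) {ζ : ℂ}
    (hζ : ζ = I ∨ ζ = -I) {y z : E}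
    (hyz : ∀ w : jointGraph G H, inner B (addSMul G H ζ w) y = inner B (w : E × E × E).1 z) :
    ∃ q : jointGraph G H, (q : E × E × E).1 = y ∧ addSMul G H (-ζ) q = z := by
  have hG := h.left
  have hH := h.right
  have hζs : star ζ = -ζ := by rcases hζ with rfl | rfl <;> simp
  obtain ⟨m, hm, hsys⟩ := h.exists_addSMul_system
  -- With `D = G + ζH` and `e = y - q`, these data give `Dp = -m e` and `⟨Dp, e⟩ = m⟨p, p⟩`. So
  -- `-⟨e, e⟩ = ⟨p, p⟩`, and positivity makes both vanish.
  obtain ⟨p, q, h1, h2⟩ := hsys m (le_abs_self m) ζ hζ z (-((m : ℂ) • y))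
  have hm0 : (m : ℂ) ≠ 0 := ofReal_ne_zero.2 hm.ne'
  set e := y - (q : E × E × E).1 with he
  have h3 : addSMul G H ζ p = -((m : ℂ) • e) := by
    rw [sub_eq_iff_eq_add.1 h2, he, smul_sub]; abel
  have h4 : inner B (addSMul G H ζ p) e = inner B (p : E × E × E).1 ((m : ℂ) • (p : E × E × E).1) := by
    rw [he, CStarModule.inner_sub_right, hyz, inner_addSMul_left hG hH hζs,
      ← CStarModule.inner_sub_right, ← h1, add_sub_cancel_left]
  rw [h3, CStarModule.inner_neg_left, CStarModule.inner_smul_left_complex,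
    CStarModule.inner_smul_right_complex, RCLike.star_def, conj_ofReal, ← smul_neg] at h4
  have h5 := smul_right_injective B hm0 h4
  have he0 : inner B e e = 0 := by
    refine le_antisymm ?_ CStarModule.inner_self_nonneg
    rw [← neg_nonneg, h5]
    exact CStarModule.inner_self_nonneg
  have hp0 : (p : E × E × E).1 = 0 := by
    rw [← CStarModule.inner_self (A := B), ← h5, he0, neg_zero]
  refine ⟨q, ?_, ?_⟩
  · exact (sub_eq_zero.1 (CStarModule.inner_self.1 he0)).symm
  · rw [← h1, hp0, smul_zero, add_zero]

/-- The domain of the commutator is a joint core. -/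
theorem exists_joint_core_seq [CompleteSpace E] (h : IsWeaklyCommutingGraph B G H)
    (w : jointGraph G H) : ∃ (p : ℕ → jointGraph G H) (c d s : ℕ → E),
      Tendsto (fun n => (p n : E × E × E)) atTop (𝓝 w) ∧
      ∀ n, ((p n : E × E × E).2.1, s n) ∈ G ∧ ((p n : E × E × E).2.1, c n) ∈ H ∧
        ((p n : E × E × E).2.2, d n) ∈ G := by
  obtain ⟨M, δ, hM, hδ, hcomm⟩ := h.exists_isSmoothedCommutator
  have hG := h.left
  obtain ⟨⟨w, a, b⟩, hw⟩ := w
  obtain ⟨hwa, hwb⟩ := mem_jointGraph.1 hw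
  simp only at hwa hwb
  let ε : ℕ → ℝ := fun n => δ / (n + 1)
  have hεpos : ∀ n, 0 < ε n := fun n => by positivity
  have hε0 : ∀ n, ε n ≠ 0 := fun n => (hεpos n).ne'
  have hεδ : ∀ n, |ε n| ≤ δ := fun n => by
    rw [abs_of_pos (hεpos n)]
    exact div_le_self hδ.le (by linarith [n.cast_nonneg (α := ℝ)])
  have hεt0 : Tendsto ε atTop (𝓝 0) := by
    simpa [ε, div_eq_mul_inv] using
      (tendsto_one_div_add_atTop_nhds_zero_nat (𝕜 := ℝ)).const_mul δ
  have hεt : Tendsto ε atTop (𝓝[≠] 0) := tendsto_nhdsWithin_iff.2 ⟨hεt0, .of_forall hε0⟩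
  choose k hk hkM using fun n => hcomm (ε n) (hε0 n) (hεδ n) w b hwb
  -- For `w ∈ D(G)` the vectors `σ_ε w = PGw` stay bounded, hence so do the commutators, and the
  -- correction `iεPk` in `HPw` tends to `0`.
  have hkM' : ∀ n, ‖smoothing G (ε n) (k n)‖ ≤ M * (‖w‖ + ‖a‖ + ‖b‖) := fun n => by
    refine (hG.norm_smoothing_le (hε0 n) _).trans ((hkM n).trans ?_)
    gcongr
    rw [(hG.smoothing_mem (hε0 n) hwa).2]
    exact hG.norm_smoothing_le (hε0 n) _
  have t0 : Tendsto (fun n => (ε n * I : ℂ) • smoothing G (ε n) (k n)) atTop (𝓝 0) := by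
    refine squeeze_zero_norm (a := fun n => ε n * (M * (‖w‖ + ‖a‖ + ‖b‖))) (fun n => ?_)
      (by simpa using hεt0.mul_const (M * (‖w‖ + ‖a‖ + ‖b‖)))
    rw [norm_smul, norm_mul, norm_I, mul_one, norm_real, Real.norm_of_nonneg (hεpos n).le]
    exact mul_le_mul_of_nonneg_left (hkM' n) (hεpos n).le
  have t1 := (hG.tendsto_smoothing w).comp hεt
  have t2 := (hG.tendsto_yosida hwa).comp hεt
  have t3 := ((hG.tendsto_smoothing b).comp hεt).add t0
  rw [add_zero] at t3
  refine ⟨fun n => ⟨(smoothing G (ε n) w, yosida G (ε n) w, _), hG.mem (hε0 n) w,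
    (hk n).smoothing_mem⟩, _, _, fun n => yosida G (ε n) a, t1.prodMk_nhds (t2.prodMk_nhds t3),
    fun n => ⟨?_, (hk n).yosida_mem, (hk n).mem⟩⟩
  change (yosida G (ε n) w, yosida G (ε n) a) ∈ G
  rw [(hG.smoothing_mem (hε0 n) hwa).2]
  exact hG.mem (hε0 n) a

/-- The commutator extends to the intersection of the domains. -/
theorem exists_commutator_extension [CompleteSpace E] (h : IsWeaklyCommutingGraph B G H)
    (x : jointGraph G H) : ∃ l : E, ∀ (w : jointGraph G H) (c d : E),
      ((w : E × E × E).2.1, c) ∈ H → ((w : E × E × E).2.2, d) ∈ G →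
      inner B (d - c) (x : E × E × E).1 = -inner B (w : E × E × E).1 l := by
  have hG := h.left
  have hH := h.right
  obtain ⟨κ, hκ, hbound⟩ := h.commutator_bound
  obtain ⟨p, c, d, s, hp, hps⟩ := h.exists_joint_core_seq x
  -- The commutator is bounded in the joint graph norm, so it has a limit `l` along a joint core
  -- sequence. Its antisymmetry on the core passes to that limit.
  have hcauchy : CauchySeq fun n => d n - c n := by
    have hpc := hp.cauchySeq
    rw [Metric.cauchySeq_iff] at hpc ⊢
    intro r hr
    obtain ⟨N, hN⟩ := hpc (r / (3 * κ)) (by positivity)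
    refine ⟨N, fun n hn k hk => ?_⟩
    have h1 := hN n hn k hk
    rw [lt_div_iff₀' (by positivity)] at h1
    refine lt_of_le_of_lt ?_ h1
    rw [dist_eq_norm, dist_eq_norm]
    have h2 := hbound (x := (p n : E × E × E).1 - (p k : E × E × E).1)
      (a := (p n : E × E × E).2.1 - (p k : E × E × E).2.1)
      (b := (p n : E × E × E).2.2 - (p k : E × E × E).2.2)
      (c := c n - c k) (d := d n - d k) (G.sub_mem (mem_jointGraph.1 (p n).2).1 (mem_jointGraph.1 (p k).2).1)
      (H.sub_mem (mem_jointGraph.1 (p n).2).2 (mem_jointGraph.1 (p k).2).2)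
      (H.sub_mem (hps n).2.1 (hps k).2.1) (G.sub_mem (hps n).2.2 (hps k).2.2)
    have e : d n - c n - (d k - c k) = d n - d k - (c n - c k) := by abel
    rw [e]
    refine h2.trans ?_
    have h3 := norm_fst_le ((p n : E × E × E) - (p k : E × E × E))
    have h4 := norm_snd_le ((p n : E × E × E) - (p k : E × E × E))
    have h5 := (norm_fst_le ((p n : E × E × E) - (p k : E × E × E)).2).trans h4
    have h6 := (norm_snd_le ((p n : E × E × E) - (p k : E × E × E)).2).trans h4
    simp only [Prod.fst_sub, Prod.snd_sub] at h3 h5 h6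
    nlinarith
  obtain ⟨l, hl⟩ := cauchySeq_tendsto_of_complete hcauchy
  refine ⟨l, fun w c' d' hc' hd' => ?_⟩
  have hp1 : Tendsto (fun n => (p n : E × E × E).1) atTop (𝓝 (x : E × E × E).1) :=
    (continuous_fst.tendsto _).comp hp
  have hci : ∀ y : E, Continuous fun z : E => inner B y z := fun y =>
    (CStarModule.continuous_inner (A := B) (E := E)).comp (by fun_prop : Continuous
      fun z : E => (y, z))
  refine tendsto_nhds_unique (((hci (d' - c')).tendsto _).comp hp1)
    ((((hci (w : E × E × E).1).tendsto _).comp hl).neg.congr fun n => ?_)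
  obtain ⟨w1, w2⟩ := mem_jointGraph.1 w.2
  obtain ⟨q1, q2⟩ := mem_jointGraph.1 (p n).2
  simp only [Function.comp_apply, CStarModule.inner_sub_left, CStarModule.inner_sub_right]
  rw [hG.symm hd' q1, hH.symm w2 (hps n).2.1, hH.symm hc' q2, hG.symm w1 (hps n).2.2]
  abel

/-- Second order regularity. -/
theorem exists_secondOrderGraph [CompleteSpace E] (h : IsWeaklyCommutingGraph B G H) {ζ : ℂ}
    (hζ : ζ = I ∨ ζ = -I) (x y : jointGraph G H) (hxy : (y : E × E × E).1 = addSMul G H ζ x) :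
    ∃ p ∈ secondOrderGraph G H, p.1 = x := by
  have hG := h.left
  have hH := h.right
  have hζs : star ζ = -ζ := by rcases hζ with rfl | rfl <;> simp
  have hζs' : star (-ζ) = ζ := by rw [star_neg, hζs, neg_neg]
  have hζ' : -ζ = I ∨ -ζ = -I := by rcases hζ with rfl | rfl <;> simp
  have hζζ : ζ * ζ = -1 := by rcases hζ with rfl | rfl <;> simp
  obtain ⟨hx1, hx2⟩ := mem_jointGraph.1 x.2
  obtain ⟨hy1, hy2⟩ := mem_jointGraph.1 y.2
  obtain ⟨l, hl⟩ := h.exists_commutator_extension x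
  -- For `w` in the core, `G(G - ζH)w = (G - ζH)Gw - ζ[G, H]w`; pairing with `x` gives `⟨Gw, y⟩ -
  -- ζ⟨w, l⟩ = ⟨w, Gy - ζl⟩`. Thus `Gx` lies in the domain of the adjoint of `G - ζH`, which is
  -- `D(G) ∩ D(H)`.
  have key : ∀ w : jointGraph G H, inner B (addSMul G H (-ζ) w) (x : E × E × E).2.1 =
      inner B (w : E × E × E).1 ((y : E × E × E).2.1 - ζ • l) := by
    intro w
    obtain ⟨p, c, d, s, hp, hps⟩ := h.exists_joint_core_seq w
    have hci : ∀ y : E, Continuous fun z : E => inner B z y := fun y =>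
      (CStarModule.continuous_inner (A := B) (E := E)).comp (by fun_prop : Continuous
        fun z : E => (z, y))
    have hA : Continuous fun q : E × E × E => q.2.1 + (-ζ) • q.2.2 := by fun_prop
    have t1 := (((hci (x : E × E × E).2.1).comp hA).tendsto _).comp hp
    have t2 := (((hci ((y : E × E × E).2.1 - ζ • l)).comp continuous_fst).tendsto _).comp hp
    refine tendsto_nhds_unique t1 (t2.congr fun n => ?_)
    obtain ⟨hs, hc, hd⟩ := hps n
    obtain ⟨p1, p2⟩ := mem_jointGraph.1 (p n).2
    have e1 := hG.symm hs hx1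
    have e2 := hG.symm hd hx1
    have e3 := inner_addSMul_left hG hH (ζ := -ζ) (by rw [hζs', neg_neg])
      ⟨((p n : E × E × E).2.1, s n, c n), hs, hc⟩ x
    have e4 := hl (p n) (c n) (d n) hc hd
    have e5 := hG.symm p1 hy1
    rw [neg_neg, ← hxy, addSMul_apply] at e3
    simp only [Function.comp_apply, CStarModule.inner_add_left, CStarModule.inner_sub_right,
      CStarModule.inner_smul_left_complex, CStarModule.inner_smul_right_complex, hζs',
      CStarModule.inner_sub_left] at e3 e4 ⊢
    rw [← e1, ← e2, ← e5, ← e3, ← neg_eq_iff_eq_neg.2 e4, smul_neg, smul_sub]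
    abel
  obtain ⟨q, hq, -⟩ := h.exists_of_inner_addSMul_eq hζ' key
  -- From `y = Gx + ζHx` and `ζ² = -1` one gets `Hx = -ζ(y - Gx)`.
  refine ⟨(x, q, (-ζ) • (y - q)), ⟨hq, ?_⟩, rfl⟩
  change (-ζ) • ((y : E × E × E).1 - (q : E × E × E).1) = (x : E × E × E).2.2
  rw [hxy, hq, addSMul_apply, add_sub_cancel_left, smul_smul, neg_mul, hζζ, neg_neg, one_smul]

end IsWeaklyCommutingGraph

end Sum

/-! ### Solvability, uniqueness and density for `G² + H²`. -/

section Laplacian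

variable {B : Type*} {E : Type*} [NonUnitalCStarAlgebra B] [PartialOrder B] [StarOrderedRing B]
  [NormedAddCommGroup E] [NormedSpace ℂ E] [SMul B E] [CStarModule B E]

/-- The operator `ν + G² + H²` on `secondOrderGraph G H`. -/
noncomputable def shiftedLaplacian (G H : Submodule ℂ (E × E)) (ν : ℂ) :
    secondOrderGraph G H →ₗ[ℂ] E where
  toFun p := ((p : jointGraph G H × jointGraph G H × jointGraph G H).2.1 : E × E × E).2.1
    + ((p : jointGraph G H × jointGraph G H × jointGraph G H).2.2 : E × E × E).2.2
    + ν • ((p : jointGraph G H × jointGraph G H × jointGraph G H).1 : E × E × E).1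
  map_add' p q := by
    simp only [Submodule.coe_add, Prod.snd_add, Prod.fst_add, smul_add]; abel
  map_smul' c p := by
    simp only [Submodule.coe_smul, Prod.smul_snd, Prod.smul_fst, smul_add, RingHom.id_apply,
      smul_comm c]

/-- The commutator of `G` and `H` on `secondOrderGraph G H`. -/
noncomputable def secondOrderCommutator (G H : Submodule ℂ (E × E)) :
    secondOrderGraph G H →ₗ[ℂ] E where
  toFun p := ((p : jointGraph G H × jointGraph G H × jointGraph G H).2.2 : E × E × E).2.1
    - ((p : jointGraph G H × jointGraph G H × jointGraph G H).2.1 : E × E × E).2.2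
  map_add' p q := by
    simp only [Submodule.coe_add, Prod.snd_add, Prod.fst_add]; abel
  map_smul' c p := by
    simp only [Submodule.coe_smul, Prod.smul_snd, Prod.smul_fst, smul_sub, RingHom.id_apply]

/-- Pairing with `x` gives `⟨a, a⟩ + ⟨b, b⟩ + μ²⟨x, x⟩`; Cauchy–Schwarz bounds `x` first and then
`a` and `b`. The three bounded vectors are those in the commutator bound. -/
theorem norm_le_of_shiftedLaplacian {G H : Submodule ℂ (E × E)} (hG : IsSelfAdjointGraph B G)
    (hH : IsSelfAdjointGraph B H) {μ : ℝ} (hμ : 1 ≤ |μ|) {x a b s t : E} (hx : (x, a) ∈ G)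
    (ha : (a, s) ∈ G) (hx' : (x, b) ∈ H) (hb : (b, t) ∈ H) :
    ∀ z ∈ ({x, a, b} : Set E), |μ| * ‖z‖ ≤ ‖s + t + ((μ : ℂ) ^ 2) • x‖ := by
  set y := s + t + ((μ : ℂ) ^ 2) • x with hy
  have key : inner B y x = inner B a a + inner B b b + inner B ((μ : ℂ) • x) ((μ : ℂ) • x) := by
    rw [hy, CStarModule.inner_add_left, CStarModule.inner_add_left, hG.symm ha hx, hH.symm hb hx']
    simp only [CStarModule.inner_smul_left_complex, CStarModule.inner_smul_right_complex,
      RCLike.star_def, map_mul, conj_ofReal, smul_smul, sq]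
  have nn : ∀ x : E, 0 ≤ inner B x x := fun x => CStarModule.inner_self_nonneg
  have hyx : ‖inner B y x‖ ≤ ‖y‖ * ‖x‖ := CStarModule.norm_inner_le E
  have h1 : ‖(μ : ℂ) • x‖ ^ 2 ≤ ‖y‖ * ‖x‖ := (norm_sq_le_norm_of_inner_le B
    (by rw [key]; exact le_add_of_nonneg_left (add_nonneg (nn _) (nn _)))).trans hyx
  have h2 : ‖a‖ ^ 2 ≤ ‖y‖ * ‖x‖ := (norm_sq_le_norm_of_inner_le B
    (by rw [key, add_assoc]; exact le_add_of_nonneg_right (add_nonneg (nn _) (nn _)))).trans hyx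
  have h3 : ‖b‖ ^ 2 ≤ ‖y‖ * ‖x‖ := (norm_sq_le_norm_of_inner_le B
    (by rw [key]; exact le_add_of_le_of_nonneg (le_add_of_nonneg_left (nn _)) (nn _))).trans hyx
  rw [norm_smul, norm_real, Real.norm_eq_abs] at h1
  have h4 : |μ| ^ 2 * ‖x‖ ≤ ‖y‖ := by
    rcases (norm_nonneg x).eq_or_lt with h0 | h0
    · rw [← h0, mul_zero]; exact norm_nonneg _
    · refine le_of_mul_le_mul_right ?_ h0
      linarith
  have h5 : |μ| ^ 2 * (‖y‖ * ‖x‖) ≤ ‖y‖ ^ 2 := by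
    nlinarith [norm_nonneg y]
  rintro z (rfl | rfl | rfl)
  · refine le_trans ?_ h4
    gcongr
    nlinarith
  · refine le_of_sq_le_sq ?_ (norm_nonneg _)
    rw [mul_pow]
    exact (mul_le_mul_of_nonneg_left h2 (by positivity)).trans h5
  · refine le_of_sq_le_sq ?_ (norm_nonneg _)
    rw [mul_pow]
    exact (mul_le_mul_of_nonneg_left h3 (by positivity)).trans h5

namespace IsWeaklyCommutingGraph

variable {G H : Submodule ℂ (E × E)}

/-- `(G - ζ H)(G + ζ H) + μ²` is surjective, where `ζ = ± i`. -/
theorem exists_adjoint_mul_system [CompleteSpace E] (h : IsWeaklyCommutingGraph B G H) :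
    ∃ m : ℝ, 0 < m ∧ ∀ μ : ℝ, m ≤ μ → ∀ ζ : ℂ, ζ = I ∨ ζ = -I → ∀ f : E,
      ∃ (p : secondOrderGraph G H) (q : jointGraph G H),
        addSMul G H (-ζ) q + (μ : ℂ) • (p.1.1 : E × E × E).1 = f ∧
        addSMul G H ζ p.1.1 = (μ : ℂ) • (q : E × E × E).1 := by
  obtain ⟨m, hm, hsys⟩ := h.exists_addSMul_system
  refine ⟨m, hm, fun μ hμ ζ hζ f => ?_⟩
  obtain ⟨p, q, h1, h2⟩ := hsys μ (hμ.trans (le_abs_self μ)) ζ hζ f 0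
  rw [sub_eq_zero] at h2
  -- With second datum `0`, the vector `(G + ζH)p = μq` lies in the joint domain, so second order
  -- regularity applies.
  obtain ⟨P, hP, rfl⟩ := h.exists_secondOrderGraph hζ p ((μ : ℂ) • q) h2.symm
  exact ⟨⟨P, hP⟩, q, h1, h2⟩

/-- `μ² + G² + H²` is surjective. -/
theorem exists_surjective_shiftedLaplacian [CompleteSpace E] (h : IsWeaklyCommutingGraph B G H) :
    ∃ m : ℝ, 1 ≤ m ∧ Function.Surjective (shiftedLaplacian G H ((m : ℂ) ^ 2)) := by
  have hG := h.left
  have hH := h.right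
  obtain ⟨m, hm, hsys⟩ := h.exists_adjoint_mul_system
  obtain ⟨κ, hκ, hbound⟩ := h.commutator_bound
  -- Three terms, each at most `κ/μ` times the norm of the shifted Laplacian: `12κ ≤ μ` yields the
  -- factor `1/4`.
  set μ := max m (max 1 (12 * κ)) with hμdef
  have hμ1 : 1 ≤ μ := (le_max_left _ _).trans (le_max_right _ _)
  have hμκ : 12 * κ ≤ μ := (le_max_right _ _).trans (le_max_right _ _)
  have hμabs : |μ| = μ := abs_of_nonneg (by linarith)
  refine ⟨μ, hμ1, ?_⟩
  have hC : ∀ p, ‖secondOrderCommutator G H p‖ ≤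
      1 / 4 * ‖shiftedLaplacian G H ((μ : ℂ) ^ 2) p‖ := by
    rintro ⟨⟨⟨⟨x, a, b⟩, hx⟩, ⟨⟨a', s, c⟩, ha⟩, ⟨⟨b', d, t⟩, hb⟩⟩, h1, h2⟩
    simp only at h1 h2
    subst h1 h2
    rw [mem_jointGraph] at hx ha hb
    simp only at hx ha hb
    have h3 := norm_le_of_shiftedLaplacian hG hH (hμabs.symm ▸ hμ1) hx.1 ha.1 hx.2 hb.2
    rw [hμabs] at h3
    have h4 := hbound hx.1 hx.2 ha.2 hb.1
    have hx3 := h3 x (by simp)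
    have ha3 := h3 a' (by simp)
    have hb3 := h3 b' (by simp)
    change ‖d - c‖ ≤ 1 / 4 * ‖s + t + ((μ : ℂ) ^ 2) • x‖
    have h5 : 12 * κ * (‖x‖ + ‖a'‖ + ‖b'‖) ≤ μ * (‖x‖ + ‖a'‖ + ‖b'‖) := by gcongr
    linarith
  -- This is `μ² + (G - iH)(G + iH)`, surjective by the first order system. Since the commutator is
  -- at most `1/4` of the Laplacian, it is at most `1/3` of `A` and can be removed.
  set A := shiftedLaplacian G H ((μ : ℂ) ^ 2) + I • secondOrderCommutator G H with hA
  have hAs : Function.Surjective A := by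
    intro f
    obtain ⟨p, q, h1, h2⟩ := hsys μ (le_max_left _ _) I (.inl rfl) ((μ : ℂ)⁻¹ • f)
    refine ⟨p, ?_⟩
    obtain ⟨⟨⟨⟨x, a, b⟩, hx⟩, ⟨⟨a', s, c⟩, ha⟩, ⟨⟨b', d, t⟩, hb⟩⟩, h3, h4⟩ := p
    simp only at h3 h4
    subst h3 h4
    rw [mem_jointGraph] at hx ha hb
    simp only at hx ha hb
    obtain ⟨⟨q, q', q''⟩, hq⟩ := q
    rw [mem_jointGraph] at hq
    simp only at hq
    have h2' : a' + I • b' = (μ : ℂ) • q := h2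
    have h1' : q' + (-I) • q'' + (μ : ℂ) • x = (μ : ℂ)⁻¹ • f := h1
    have e1 : (μ : ℂ) • q' = s + I • d := by
      refine hG.eq_of_mem (x := a' + I • b') ?_ (G.add_mem ha.1 (G.smul_mem I hb.1))
      rw [h2']
      exact G.smul_mem (μ : ℂ) hq.1
    have e2 : (μ : ℂ) • q'' = c + I • t := by
      refine hH.eq_of_mem (x := a' + I • b') ?_ (H.add_mem ha.2 (H.smul_mem I hb.2))
      rw [h2']
      exact H.smul_mem (μ : ℂ) hq.2
    have hμ0 : (μ : ℂ) ≠ 0 := ofReal_ne_zero.2 (by linarith)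
    have e3 := congrArg ((μ : ℂ) • ·) h1'
    simp only [smul_add, smul_smul, mul_inv_cancel₀ hμ0, one_smul] at e3
    rw [mul_comm _ (-I), mul_smul, e1, e2] at e3
    rw [← e3]
    change (s + t + ((μ : ℂ) ^ 2) • x) + I • (d - c) = _
    match_scalars <;> (ring_nf; try (rw [I_sq]; try ring))
  have hsub : shiftedLaplacian G H ((μ : ℂ) ^ 2) = A + (-I) • secondOrderCommutator G H := by
    rw [hA, neg_smul, add_neg_cancel_right]
  rw [hsub]
  refine surjective_add_of_norm_le (V := secondOrderGraph G H) (X := E) A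
    ((-I) • secondOrderCommutator G H) hAs (θ := 1 / 3) (by norm_num) (by norm_num) fun p => ?_
  have h1 := hC p
  have h2 : ‖shiftedLaplacian G H ((μ : ℂ) ^ 2) p‖ ≤ ‖A p‖ + ‖secondOrderCommutator G H p‖ := by
    rw [hsub, LinearMap.add_apply, LinearMap.smul_apply]
    refine (norm_add_le _ _).trans_eq ?_
    rw [norm_smul, norm_neg, norm_I, one_mul]
  rw [LinearMap.smul_apply, norm_smul, norm_neg, norm_I, one_mul]
  linarith

/-- The domain of `G² + H²` is contained in the domain of the commutator. -/
theorem exists_secondOrderGraph_of_mem [CompleteSpace E] (h : IsWeaklyCommutingGraph B G H)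
    {x a b s t : E} (hx : (x, a) ∈ G) (ha : (a, s) ∈ G) (hx' : (x, b) ∈ H) (hb : (b, t) ∈ H) :
    ∃ p ∈ secondOrderGraph G H, (p.1 : E × E × E) = (x, a, b) := by
  have hG := h.left
  have hH := h.right
  obtain ⟨μ, hμ, hsurj⟩ := h.exists_surjective_shiftedLaplacian
  have hμ' : 1 ≤ |μ| := hμ.trans (le_abs_self μ)
  -- Solve inside `secondOrderGraph` with the right-hand side of `x`; the lower bound forces the
  -- solution to be `x`.
  obtain ⟨p, hp⟩ := hsurj (s + t + ((μ : ℂ) ^ 2) • x)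
  refine ⟨p, p.2, ?_⟩
  obtain ⟨⟨⟨⟨x', a', b'⟩, hx₁⟩, ⟨⟨a'', s', c⟩, ha₁⟩, ⟨⟨b'', d, t'⟩, hb₁⟩⟩, h3, h4⟩ := p
  simp only at h3 h4
  subst h3 h4
  rw [mem_jointGraph] at hx₁ ha₁ hb₁
  simp only at hx₁ ha₁ hb₁
  have hp' : s' + t' + ((μ : ℂ) ^ 2) • x' = s + t + ((μ : ℂ) ^ 2) • x := hp
  have h5 := norm_le_of_shiftedLaplacian hG hH hμ' (x := x' - x) (a := a'' - a)
    (b := b'' - b) (s := s' - s) (t := t' - t) (G.sub_mem hx₁.1 hx) (G.sub_mem ha₁.1 ha)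
    (H.sub_mem hx₁.2 hx') (H.sub_mem hb₁.2 hb)
  have e : s' - s + (t' - t) + ((μ : ℂ) ^ 2) • (x' - x) = 0 := by
    rw [smul_sub, ← sub_eq_zero.2 hp']; abel
  simp only [e, norm_zero] at h5
  have h6 : ∀ z ∈ ({x' - x, a'' - a, b'' - b} : Set E), z = 0 := fun z hz => by
    have := h5 z hz
    rw [← norm_le_zero_iff]
    by_contra hn
    have : 0 < |μ| * ‖z‖ := mul_pos (by linarith) (not_le.1 hn)
    linarith
  exact Prod.ext (sub_eq_zero.1 (h6 (x' - x) (by simp)))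
    (Prod.ext (sub_eq_zero.1 (h6 (a'' - a) (by simp))) (sub_eq_zero.1 (h6 (b'' - b) (by simp))))

/-- The smoothing operators map `D(H)` into `D(G) ∩ D(H)` and tend strongly to the identity. -/
theorem dense_jointGraph [CompleteSpace E] (h : IsWeaklyCommutingGraph B G H) :
    Dense (Set.range fun p : jointGraph G H => (p : E × E × E).1) := by
  obtain ⟨M, δ, hM, hδ, hcomm⟩ := h.exists_isSmoothedCommutator
  have hG := h.left
  rw [← dense_closure]
  refine h.right.dense.mono ?_
  rintro z ⟨b, hz⟩
  have hev : ∀ᶠ ε : ℝ in 𝓝[≠] 0, ε ≠ 0 ∧ |ε| ≤ δ := by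
    refine (eventually_mem_nhdsWithin).and ?_
    have : Tendsto (fun ε : ℝ => |ε|) (𝓝[≠] 0) (𝓝 0) := by
      simpa using (continuous_abs.tendsto (0 : ℝ)).mono_left nhdsWithin_le_nhds
    exact (this.eventually (gt_mem_nhds hδ)).mono fun _ => le_of_lt
  refine mem_closure_of_tendsto (hG.tendsto_smoothing z) (hev.mono fun ε hε => ?_)
  obtain ⟨k, hk, -⟩ := hcomm ε hε.1 hε.2 z b hz
  exact ⟨⟨(_, _, _), hG.mem hε.1 z, hk.smoothing_mem⟩, rfl⟩

/-- With `D = G + iH`, solve `(μ² + D*D)p = μ²x` and let `μ → ∞`. For `e = x - p` and `Dp = μq`,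
pairing gives `μ⟨e, e⟩ + μ⟨q, q⟩ = ⟨q, Dx⟩`, so `μ‖q‖ ≤ ‖Dx‖` and then `μ‖e‖ ≤ ‖Dx‖`. -/
theorem dense_secondOrderGraph [CompleteSpace E] (h : IsWeaklyCommutingGraph B G H) :
    Dense (Set.range fun p : secondOrderGraph G H => (p.1.1 : E × E × E).1) := by
  have hG := h.left
  have hH := h.right
  obtain ⟨m, hm, hsys⟩ := h.exists_adjoint_mul_system
  rw [← dense_closure]
  refine h.dense_jointGraph.mono ?_
  rintro _ ⟨x, rfl⟩
  rw [Metric.mem_closure_iff]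
  intro r hr
  set y := addSMul G H I x with hy
  obtain ⟨μ, hμm, hμr⟩ : ∃ μ : ℝ, m ≤ μ ∧ ‖y‖ < μ * r := by
    refine ⟨max m ((‖y‖ + 1) / r), le_max_left _ _, ?_⟩
    calc ‖y‖ < ‖y‖ + 1 := by linarith
      _ = (‖y‖ + 1) / r * r := by field_simp
      _ ≤ _ := by gcongr; exact le_max_right _ _
  have hμ0 : 0 < μ := hm.trans_le hμm
  obtain ⟨p, q, h1, h2⟩ := hsys μ hμm I (.inl rfl) ((μ : ℂ) • (x : E × E × E).1)
  refine ⟨_, ⟨p, rfl⟩, ?_⟩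
  rw [dist_eq_norm]
  simp only
  set e : jointGraph G H := x - p.1.1 with he
  have he1 : (x : E × E × E).1 - (p.1.1 : E × E × E).1 = (e : E × E × E).1 := rfl
  rw [he1]
  have h3 : addSMul G H (-I) q = (μ : ℂ) • (e : E × E × E).1 := by
    rw [← he1, smul_sub, ← h1, add_sub_cancel_right]
  have h4 : addSMul G H I e = y - (μ : ℂ) • (q : E × E × E).1 := by rw [he, map_sub, h2]
  have h5 := inner_addSMul_left hG hH (ζ := -I) (by simp) q e
  rw [neg_neg, h3, h4, CStarModule.inner_sub_right, CStarModule.inner_smul_left_complex,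
    CStarModule.inner_smul_right_complex, RCLike.star_def, conj_ofReal, eq_sub_iff_add_eq] at h5
  have hsq : ∀ z : E, (μ : ℂ) • inner B z z
      = inner B ((Real.sqrt μ : ℂ) • z) ((Real.sqrt μ : ℂ) • z) := fun z => by
    rw [CStarModule.inner_smul_left_complex, CStarModule.inner_smul_right_complex,
      RCLike.star_def, conj_ofReal, smul_smul, ← ofReal_mul, Real.mul_self_sqrt hμ0.le]
  have hnsq : ∀ z : E, ‖(Real.sqrt μ : ℂ) • z‖ ^ 2 = μ * ‖z‖ ^ 2 := fun z => by
    rw [norm_smul, norm_real, Real.norm_of_nonneg (Real.sqrt_nonneg _), mul_pow,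
      Real.sq_sqrt hμ0.le]
  rw [hsq, hsq] at h5
  have hqy : ‖inner B (q : E × E × E).1 y‖ ≤ ‖(q : E × E × E).1‖ * ‖y‖ :=
    CStarModule.norm_inner_le E
  have h6 := (norm_sq_le_norm_of_inner_le B
    (h5 ▸ le_add_of_nonneg_right CStarModule.inner_self_nonneg)).trans hqy
  have h7 := (norm_sq_le_norm_of_inner_le B
    (h5 ▸ le_add_of_nonneg_left CStarModule.inner_self_nonneg)).trans hqy
  rw [hnsq] at h6 h7
  have h8 : μ * ‖(q : E × E × E).1‖ ≤ ‖y‖ := by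
    rcases (norm_nonneg (q : E × E × E).1).eq_or_lt with h0 | h0
    · rw [← h0, mul_zero]; exact norm_nonneg _
    · refine le_of_mul_le_mul_right ?_ h0
      linarith
  have h9 : (μ * ‖(e : E × E × E).1‖) ^ 2 ≤ ‖y‖ ^ 2 := by
    calc (μ * ‖(e : E × E × E).1‖) ^ 2 = μ * (μ * ‖(e : E × E × E).1‖ ^ 2) := by ring
      _ ≤ μ * (‖(q : E × E × E).1‖ * ‖y‖) := by gcongr
      _ = (μ * ‖(q : E × E × E).1‖) * ‖y‖ := by ring
      _ ≤ ‖y‖ * ‖y‖ := by gcongr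
      _ = ‖y‖ ^ 2 := by ring
  have h10 := le_of_sq_le_sq h9 (norm_nonneg _)
  exact lt_of_mul_lt_mul_left (h10.trans_lt hμr) hμ0.le

end IsWeaklyCommutingGraph

end Laplacian

/-! ### From operators to graphs. -/

section Interface

variable {B : Type*} {E : Type*} [NonUnitalCStarAlgebra B] [PartialOrder B] [StarOrderedRing B]
  [NormedAddCommGroup E] [NormedSpace ℂ E] [SMul B E] [CStarModule B E]

theorem mem_graph_iff_exists {f : E →ₗ.[ℂ] E} {x y : E} :
    (x, y) ∈ f.graph ↔ ∃ h : x ∈ f.domain, f ⟨x, h⟩ = y := by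
  rw [LinearPMap.mem_graph_iff]
  constructor
  · rintro ⟨⟨z, hz⟩, rfl, h⟩
    exact ⟨hz, h⟩
  · rintro ⟨h, h'⟩
    exact ⟨⟨x, h⟩, rfl, h'⟩

theorem IsSelfAdjointOp.inner_eq {T : E →ₗ.[ℂ] E} (hT : IsSelfAdjointOp B T) {x a y b : E}
    (hx : (x, a) ∈ T.graph) (hy : (y, b) ∈ T.graph) : inner B a y = inner B x b := by
  rw [← hT.adjoint_eq, mem_graph_adjoint B hT.dense_domain] at hy
  obtain ⟨h, rfl⟩ := mem_graph_iff_exists.1 hx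
  exact hy ⟨x, h⟩

/-- A self-adjoint regular operator has resolvents at all nonzero imaginary numbers. -/
theorem isSelfAdjointGraph_graph [CompleteSpace E] {T : E →ₗ.[ℂ] E} (hT : IsSelfAdjointOp B T)
    (hT' : IsRegular B T) : IsSelfAdjointGraph B T.graph := by
  have hcomplete : CompleteSpace T.graph := hT'.isClosed.completeSpace_coe
  have key : ∀ μ : ℝ, ∀ x a : E, (x, a) ∈ T.graph →
      inner B (a + (μ * I : ℂ) • x) (a + (μ * I : ℂ) • x)
        = inner B a a + inner B ((μ : ℂ) • x) ((μ : ℂ) • x) := by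
    intro μ x a hx
    have := inner_add_imaginary_smul B (a := a) (u := x) (b := 0) (v := 0) μ
      (by rw [hT.inner_eq hx hx])
    simpa using this
  have hle : ∀ μ : ℝ, ∀ x a : E, (x, a) ∈ T.graph →
      ‖a‖ ≤ ‖a + (μ * I : ℂ) • x‖ ∧ |μ| * ‖x‖ ≤ ‖a + (μ * I : ℂ) • x‖ := by
    intro μ x a hx
    have h1 : inner B a a ≤ inner B (a + (μ * I : ℂ) • x) (a + (μ * I : ℂ) • x) := by
      rw [key μ x a hx]; exact le_add_of_nonneg_right CStarModule.inner_self_nonneg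
    have h2 : inner B ((μ : ℂ) • x) ((μ : ℂ) • x)
        ≤ inner B (a + (μ * I : ℂ) • x) (a + (μ * I : ℂ) • x) := by
      rw [key μ x a hx]; exact le_add_of_nonneg_left CStarModule.inner_self_nonneg
    have h1' := norm_sq_le_norm_of_inner_le B h1
    have h2' := norm_sq_le_norm_of_inner_le B h2
    rw [← CStarModule.norm_sq_eq B] at h1' h2'
    have h3 := le_of_sq_le_sq h2' (norm_nonneg _)
    rw [norm_smul, norm_real, Real.norm_eq_abs] at h3
    exact ⟨le_of_sq_le_sq h1' (norm_nonneg _), h3⟩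
  let Φ : ℂ → T.graph →L[ℂ] E := fun z =>
    (ContinuousLinearMap.snd ℂ E E + z • ContinuousLinearMap.fst ℂ E E).comp T.graph.subtypeL
  have hΦ : ∀ z (p : T.graph), Φ z p = (p : E × E).2 + z • (p : E × E).1 := fun z p => rfl
  have hone : ∀ σ : ℝ, σ = 1 ∨ σ = -1 → Function.Surjective (Φ (σ * I)) := by
    intro σ hσ
    have hσ1 : |σ| = 1 := by rcases hσ with rfl | rfl <;> simp
    have hσ2 : (σ : ℂ) * σ = 1 := by rcases hσ with rfl | rfl <;> simp
    have hanti : AntilipschitzWith 1 (Φ (σ * I)) :=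
      AddMonoidHomClass.antilipschitz_of_bound _ fun p => by
        obtain ⟨h1, h2⟩ := hle σ _ _ p.2
        rw [hσ1, one_mul] at h2
        rw [NNReal.coe_one, one_mul, hΦ]
        exact max_le h2 h1
    have hcl := hanti.isClosed_range (Φ (σ * I)).uniformContinuous
    -- Since `(T + iσ)(T - iσ) = T² + 1`, the range contains that of `1 + T*T`.
    have hdense : DenseRange (Φ (σ * I)) := by
      have hr := hT'.dense_range
      rw [hT.adjoint_eq] at hr
      refine hr.mono ?_
      rintro _ ⟨⟨x, hx, hx'⟩, rfl⟩
      have g1 : (x, T ⟨x, hx⟩) ∈ T.graph := T.mem_graph ⟨x, hx⟩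
      have g2 : (T ⟨x, hx⟩, T ⟨T ⟨x, hx⟩, hx'⟩) ∈ T.graph := T.mem_graph ⟨T ⟨x, hx⟩, hx'⟩
      refine ⟨⟨_, T.graph.sub_mem g2 (T.graph.smul_mem (σ * I) g1)⟩, ?_⟩
      change (T ⟨T ⟨x, hx⟩, hx'⟩ - (σ * I : ℂ) • T ⟨x, hx⟩)
        + (σ * I : ℂ) • (T ⟨x, hx⟩ - (σ * I : ℂ) • x) = x + T ⟨T ⟨x, hx⟩, hx'⟩
      have e : (σ * I : ℂ) * (σ * I) = -1 := by
        linear_combination (σ * σ : ℂ) * I_mul_I - hσ2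
      rw [smul_sub, smul_smul, e, neg_one_smul]
      abel
    rw [← Set.range_eq_univ, ← hcl.closure_eq, hdense.closure_eq]
  have hall : ∀ σ : ℝ, σ = 1 ∨ σ = -1 → ∀ r : ℝ, 0 < r →
      Function.Surjective (Φ ((σ * r : ℝ) * I)) := by
    intro σ hσ r hr
    have hσ1 : |σ| = 1 := by rcases hσ with rfl | rfl <;> simp
    let K : T.graph →ₗ[ℂ] E := ((σ * (r - 1) : ℝ) * I : ℂ) •
      (LinearMap.fst ℂ E E ∘ₗ T.graph.subtype)
    have hK : ∀ p : T.graph, K p = ((σ * (r - 1) : ℝ) * I : ℂ) • (p : E × E).1 := fun p => rfl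
    have h := surjective_add_of_path (V := T.graph) (X := E) (Φ (σ * I) : T.graph →ₗ[ℂ] E) K
      (hone σ hσ) (M := |r - 1| * (min 1 r)⁻¹) ?_
    · intro f
      obtain ⟨p, hp⟩ := h f
      refine ⟨p, ?_⟩
      rw [← hp, LinearMap.add_apply, hK, hΦ]
      change _ = (p : E × E).2 + (σ * I : ℂ) • (p : E × E).1 + _
      push_cast
      module
    · intro s hs0 hs1 p
      have e : (Φ (σ * I) : T.graph →ₗ[ℂ] E) p + (s : ℂ) • K p
          = (p : E × E).2 + ((σ * (1 + s * (r - 1)) : ℝ) * I : ℂ) • (p : E × E).1 := by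
        rw [hK]
        change (p : E × E).2 + (σ * I : ℂ) • (p : E × E).1 + _ = _
        push_cast
        module
      -- Along the path from `σi` to `σri` the shift keeps its sign and has modulus at least `min 1
      -- r`.
      have hm0 : 0 < min 1 r := lt_min one_pos hr
      have hm : min 1 r ≤ 1 + s * (r - 1) := by
        have h1 := min_le_left 1 r
        have h2 := min_le_right 1 r
        nlinarith
      have h2 := (hle (σ * (1 + s * (r - 1))) _ _ p.2).2
      rw [← e, abs_mul, hσ1, one_mul, abs_of_pos (hm0.trans_le hm)] at h2
      rw [hK, norm_smul, norm_mul, norm_I, mul_one, norm_real, Real.norm_eq_abs, abs_mul, hσ1,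
        one_mul, mul_assoc]
      gcongr
      rw [inv_mul_eq_div, le_div_iff₀' hm0]
      exact le_trans (by gcongr) h2
  refine ⟨hT.inner_eq, hT'.isClosed, ?_, ?_⟩
  · refine hT.dense_domain.mono fun x hx => ⟨T ⟨x, hx⟩, T.mem_graph ⟨x, hx⟩⟩
  · intro ε hε x
    have hε' : (ε : ℂ) ≠ 0 := ofReal_ne_zero.2 hε
    have hsurj : Function.Surjective (Φ ((-ε⁻¹ : ℝ) * I)) := by
      rcases lt_or_gt_of_ne hε with h | h
      · have := hall 1 (.inl rfl) (-ε⁻¹) (by simpa using h)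
        simpa using this
      · have := hall (-1) (.inr rfl) ε⁻¹ (by simpa using h)
        simpa using this
    obtain ⟨p, hp⟩ := hsurj (((-ε⁻¹ : ℝ) * I : ℂ) • x)
    refine ⟨(p : E × E).1, (p : E × E).2, p.2, ?_⟩
    have e : (ε * I : ℂ) * ((-ε⁻¹ : ℝ) * I : ℂ) = 1 := by
      push_cast
      linear_combination (-1 : ℂ) * I_mul_I + (-I * I) * (mul_inv_cancel₀ hε')
    have h := congrArg ((ε * I : ℂ) • ·) hp
    simp only [hΦ, smul_add, smul_smul, e, one_smul] at h
    rw [add_comm]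
    exact h

theorem IsWeaklyCommuting.isWeaklyCommutingGraph [CompleteSpace E] {S T : E →ₗ.[ℂ] E}
    (h : IsWeaklyCommuting B S T) : IsWeaklyCommutingGraph B S.graph T.graph := by
  have hS := isSelfAdjointGraph_graph h.selfAdjoint_left h.regular_left
  have hT := isSelfAdjointGraph_graph h.selfAdjoint_right h.regular_right
  refine ⟨hS, hT, ?_, ?_⟩
  · obtain ⟨C₀, C₁, C₂, h0, h1, h2, hC⟩ := h.form_estimate
    -- Each squared norm is at most the square of the sum of the three norms.
    refine ⟨Real.sqrt (C₀ + C₁ + C₂), by positivity, ?_⟩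
    intro x a b c d hxa hxb hac hbd
    obtain ⟨hxS, rfl⟩ := mem_graph_iff_exists.1 hxa
    obtain ⟨hxT, rfl⟩ := mem_graph_iff_exists.1 hxb
    obtain ⟨hST, rfl⟩ := mem_graph_iff_exists.1 hac
    obtain ⟨hTS, rfl⟩ := mem_graph_iff_exists.1 hbd
    have hx : x ∈ (commutatorOp S T).domain := mem_commutatorOp_domain.2 ⟨hxS, hxT, hST, hTS⟩
    have h3 := norm_sq_le_norm_of_inner_le B (hC x hx hxS hxT)
    have e : commutatorOp S T ⟨x, hx⟩ = S ⟨T ⟨x, hxT⟩, hTS⟩ - T ⟨S ⟨x, hxS⟩, hST⟩ := rfl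
    rw [e] at h3
    refine le_of_sq_le_sq (h3.trans ?_) (by positivity)
    rw [mul_pow, Real.sq_sqrt (by positivity)]
    refine norm_add₃_le.trans ?_
    simp only [norm_smul, ← CStarModule.norm_sq_eq B, Real.norm_of_nonneg h0.le,
      Real.norm_of_nonneg h1.le, Real.norm_of_nonneg h2.le, add_mul]
    have n0 := norm_nonneg x
    have n1 := norm_nonneg (S ⟨x, hxS⟩)
    have n2 := norm_nonneg (T ⟨x, hxT⟩)
    gcongr <;> linarith
  · obtain ⟨𝓔, hcore, l₀, hl₀, hl⟩ := h.core_condition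
    refine ⟨{p | p ∈ T.graph ∧ p.1 ∈ 𝓔}, fun p hp => hp.1, ?_, 1 / l₀, by positivity, ?_⟩
    · have hle : T.domRestrict 𝓔 ≤ T := LinearPMap.domRestrict_le
      have hclos : (T.domRestrict 𝓔).IsClosable :=
        h.regular_right.isClosed.isClosable.leIsClosable hle
      have hgraph := hclos.graph_closure_eq_closure_graph
      rw [hcore.closure_eq] at hgraph
      have hsub : ((T.domRestrict 𝓔).graph : Set (E × E)) ⊆ {p | p ∈ T.graph ∧ p.1 ∈ 𝓔} := by
        intro p hp
        refine ⟨LinearPMap.le_graph_of_le hle hp, ?_⟩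
        obtain ⟨hx, -⟩ := (mem_graph_iff_exists (x := p.1) (y := p.2)).1 hp
        exact hx.1
      intro p hp
      rw [← hgraph] at hp
      exact closure_mono hsub hp
    · rintro ε hε hεl ⟨z, b⟩ ⟨-, hz⟩
      simp only at hz
      have hε' : (ε : ℂ) ≠ 0 := ofReal_ne_zero.2 hε
      obtain ⟨hPS, hPσ⟩ := mem_graph_iff_exists.1 (hS.mem hε z)
      -- With `λ = -i/ε`, `(1 + iεS)⁻¹z = (S + λ)⁻¹(λz)`, and `λz` is again in `𝓔`. The condition
      -- `|λ| ≥ l₀` reads `|ε| ≤ 1/l₀`.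
      have hmem := hl (-ε⁻¹) (by
        rw [abs_neg, abs_inv, ← one_div, le_div_iff₀ (abs_pos.2 hε)]
        rwa [le_div_iff₀ hl₀, mul_comm] at hεl) ⟨smoothing S.graph ε z, hPS⟩ (by
        have e : S ⟨smoothing S.graph ε z, hPS⟩
            + (I * ((-ε⁻¹ : ℝ) : ℂ)) • smoothing S.graph ε z = (I * ((-ε⁻¹ : ℝ) : ℂ)) • z := by
          rw [hPσ]
          have e1 : (I * ((-ε⁻¹ : ℝ) : ℂ)) * (ε * I) = 1 := by
            push_cast
            linear_combination (-1 : ℂ) * I_mul_I + (-I * I) * (mul_inv_cancel₀ hε')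
          have e2 := congrArg ((I * ((-ε⁻¹ : ℝ) : ℂ)) • ·) (hS.smoothing_add_yosida hε z)
          simp only [smul_add, smul_smul, e1, one_smul] at e2
          rw [add_comm]
          exact e2
        rw [e]
        exact 𝓔.smul_mem _ hz)
      obtain ⟨hxS, hxT, hST, hTS⟩ := mem_commutatorOp_domain.1 hmem
      rw [hPσ] at hST
      exact ⟨_, _, _, T.mem_graph ⟨_, hxT⟩, T.mem_graph ⟨_, hST⟩, S.mem_graph ⟨_, hTS⟩⟩

end Interface

/-! ### Self-adjointness, regularity and domains. -/

section Final

variable {B : Type*} {E : Type*} [NonUnitalCStarAlgebra B] [PartialOrder B] [StarOrderedRing B]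
  [NormedAddCommGroup E] [NormedSpace ℂ E] [SMul B E] [CStarModule B E]

/-- A symmetric densely defined operator `L` such that `L + ν` is surjective for some real `ν` is
self-adjoint. -/
theorem isSelfAdjointOp_of_surjective {L : E →ₗ.[ℂ] E} (hdense : Dense (L.domain : Set E))
    (hsymm : ∀ {x a y b : E}, (x, a) ∈ L.graph → (y, b) ∈ L.graph → inner B a y = inner B x b)
    {ν : ℝ} (hsurj : ∀ f : E, ∃ x a, (x, a) ∈ L.graph ∧ a + (ν : ℂ) • x = f) :
    IsSelfAdjointOp B L := by
  refine ⟨hdense, LinearPMap.eq_of_eq_graph (SetLike.ext ?_)⟩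
  rintro ⟨y, z⟩
  rw [mem_graph_adjoint B hdense]
  constructor
  · intro h
    -- The solution `x₀` of `(L + ν)x₀ = z + νy` must be `y`: the difference `y - x₀` is orthogonal
    -- to the range of `L + ν`, in particular to itself.
    obtain ⟨x₀, a₀, h₀, h₁⟩ := hsurj (z + (ν : ℂ) • y)
    obtain ⟨x, a, hx, hxa⟩ := hsurj (y - x₀)
    obtain ⟨hxL, rfl⟩ := mem_graph_iff_exists.1 hx
    have h2 : inner B (L ⟨x, hxL⟩ + (ν : ℂ) • x) (y - x₀) = 0 := by
      have e : inner B (L ⟨x, hxL⟩ + (ν : ℂ) • x) (y - x₀)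
          = inner B x (z + (ν : ℂ) • y) - inner B x (a₀ + (ν : ℂ) • x₀) := by
        simp only [CStarModule.inner_add_left, CStarModule.inner_sub_right,
          CStarModule.inner_add_right, CStarModule.inner_smul_left_complex,
          CStarModule.inner_smul_right_complex, RCLike.star_def, conj_ofReal, h ⟨x, hxL⟩,
          hsymm hx h₀]
      rw [e, h₁, sub_self]
    rw [hxa] at h2
    have h3 : y = x₀ := sub_eq_zero.1 (CStarModule.inner_self.1 h2)
    subst h3
    rwa [← add_right_cancel h₁]
  · intro h x
    exact hsymm (L.mem_graph x) h

theorem IsSelfAdjointOp.isClosed {L : E →ₗ.[ℂ] E} (hL : IsSelfAdjointOp B L) : L.IsClosed := by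
  have e : (L.graph : Set (E × E)) =
      {p | ∀ x : L.domain, inner B (L x) p.1 = inner B (x : E) p.2} := by
    ext ⟨y, z⟩
    rw [SetLike.mem_coe, ← hL.adjoint_eq, mem_graph_adjoint B hL.dense_domain, hL.adjoint_eq]
    rfl
  rw [LinearPMap.IsClosed, e, Set.ofPred_forall]
  refine isClosed_iInter fun x => isClosed_eq ?_ ?_
  · exact (CStarModule.continuous_inner (A := B) (E := E)).comp
      (by fun_prop : Continuous fun p : E × E => (L x, p.1))
  · exact (CStarModule.continuous_inner (A := B) (E := E)).comp
      (by fun_prop : Continuous fun p : E × E => ((x : E), p.2))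

/-- A positive self-adjoint operator `L` such that `L + ν` is surjective for some `ν > 0` is
regular. -/
theorem isRegular_of_surjective [CompleteSpace E] {L : E →ₗ.[ℂ] E} (hL : IsSelfAdjointOp B L)
    (hnonneg : ∀ {x a : E}, (x, a) ∈ L.graph → 0 ≤ inner B a x)
    (hB : ∀ (b : B) {x a : E}, (x, a) ∈ L.graph → (b • x, b • a) ∈ L.graph)
    {ν : ℝ} (hν : 0 < ν) (hsurj : ∀ f : E, ∃ x a, (x, a) ∈ L.graph ∧ a + (ν : ℂ) • x = f) :
    IsRegular B L := by
  have hle : ∀ w : ℂ, 0 ≤ w.re → ∀ p : L.graph,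
      ‖w‖ * ‖(p : E × E).1‖ ≤ ‖(p : E × E).2 + w • (p : E × E).1‖ := by
    rintro w hw ⟨⟨x, a⟩, hx⟩
    have hs := hL.inner_eq hx hx
    have e : inner B (a + w • x) (a + w • x)
        = inner B a a + (2 * w.re) • inner B a x + inner B (w • x) (w • x) := by
      have e1 : ((2 * w.re : ℝ) : ℂ) = w + star w := (add_conj w).symm
      rw [← Complex.coe_smul, e1]
      simp only [CStarModule.inner_add_left, CStarModule.inner_add_right,
        CStarModule.inner_smul_left_complex, CStarModule.inner_smul_right_complex, hs, add_smul, smul_add]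
      abel
    have h1 : inner B (w • x) (w • x) ≤ inner B (a + w • x) (a + w • x) := by
      rw [e]
      exact le_add_of_nonneg_left (add_nonneg CStarModule.inner_self_nonneg
        (smul_nonneg (by positivity) (hnonneg hx)))
    have h2 := norm_sq_le_norm_of_inner_le B h1
    rw [← CStarModule.norm_sq_eq B] at h2
    rw [← norm_smul]
    exact le_of_sq_le_sq h2 (norm_nonneg _)
  let A : ℂ → L.graph →ₗ[ℂ] E := fun w =>
    (LinearMap.snd ℂ E E + w • LinearMap.fst ℂ E E) ∘ₗ L.graph.subtype
  have hA : ∀ w (p : L.graph), A w p = (p : E × E).2 + w • (p : E × E).1 := fun w p => rfl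
  have hAν : Function.Surjective (A ν) := by
    intro f
    obtain ⟨x, a, hx, hf⟩ := hsurj f
    exact ⟨⟨(x, a), hx⟩, hf⟩
  have hAI : ∀ z : ℂ, z.re = 0 → |z.im| = 1 → Function.Surjective (A z) := by
    intro z hz0 hz1
    let K : L.graph →ₗ[ℂ] E := (z - ν) • (LinearMap.fst ℂ E E ∘ₗ L.graph.subtype)
    have hK : ∀ p : L.graph, K p = (z - ν) • (p : E × E).1 := fun p => rfl
    have hc0 : 0 < min ν 1 / 2 := by positivity
    -- The segment from `ν` to `z = ±i` stays in the closed right half-plane, where positivity gives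
    -- the lower bound `|w|`. For `s ≤ 1/2` the real part is at least `ν/2`, and for `s ≥ 1/2` the
    -- imaginary part has modulus at least `1/2`.
    have h := surjective_add_of_path (V := L.graph) (X := E) (A ν) K hAν
      (M := ‖z - ν‖ * (min ν 1 / 2)⁻¹) ?_
    · intro f
      obtain ⟨p, hp⟩ := h f
      refine ⟨p, ?_⟩
      rw [← hp, LinearMap.add_apply, hK, hA, hA]
      module
    · intro s hs0 hs1 p
      have e : A ν p + (s : ℂ) • K p
          = (p : E × E).2 + (ν + s * (z - ν) : ℂ) • (p : E × E).1 := by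
        rw [hK, hA]
        module
      have hre : (ν + s * (z - ν) : ℂ).re = (1 - s) * ν := by
        simp [hz0]; ring
      have him : |(ν + s * (z - ν) : ℂ).im| = s := by
        simp [abs_mul, hz1, abs_of_nonneg hs0]
      have hre0 : 0 ≤ (ν + s * (z - ν) : ℂ).re := by
        rw [hre]; exact mul_nonneg (by linarith) hν.le
      have hc : min ν 1 / 2 ≤ ‖(ν + s * (z - ν) : ℂ)‖ := by
        have h1 := abs_im_le_norm (ν + s * (z - ν) : ℂ)
        have h2 := (le_abs_self _).trans (abs_re_le_norm (ν + s * (z - ν) : ℂ))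
        rw [him] at h1
        rw [hre] at h2
        rcases le_total s (1 / 2) with h | h
        · refine le_trans ?_ h2
          nlinarith [min_le_left ν 1]
        · refine le_trans ?_ h1
          linarith [min_le_right ν 1]
      have h2 := hle _ hre0 p
      rw [e, hK, norm_smul, mul_assoc]
      gcongr
      rw [inv_mul_eq_div, le_div_iff₀' hc0]
      exact le_trans (by gcongr) h2
  have hBmem : ∀ (b : B) (x : E), x ∈ L.domain → b • x ∈ L.domain := fun b x hx =>
    LinearPMap.mem_domain_of_mem_graph (hB b (L.mem_graph ⟨x, hx⟩))
  refine ⟨hL.dense_domain, hBmem, ?_, hL.isClosed, ?_, ?_⟩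
  · intro b x hx
    exact L.mem_graph_snd_inj (L.mem_graph ⟨b • x, hBmem b x hx⟩) (hB b (L.mem_graph ⟨x, hx⟩)) rfl
  · rw [hL.adjoint_eq]; exact hL.dense_domain
  · rw [hL.adjoint_eq]
    refine Function.Surjective.denseRange ?_
    intro f
    -- Factor `1 + L² = (L + i)(L - i)` and solve twice.
    obtain ⟨⟨⟨y, b⟩, hy⟩, hyf⟩ := hAI I (by simp) (by simp) f
    obtain ⟨⟨⟨x, a⟩, hx⟩, hxy⟩ := hAI (-I) (by simp) (by simp) y
    rw [hA] at hyf hxy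
    simp only at hyf hxy
    obtain ⟨hxL, rfl⟩ := mem_graph_iff_exists.1 hx
    have e1 : L ⟨x, hxL⟩ = y + I • x := by rw [← hxy]; module
    have h2 : (L ⟨x, hxL⟩, b + I • L ⟨x, hxL⟩) ∈ L.graph := by
      have := L.graph.add_mem hy (L.graph.smul_mem I hx)
      rw [Prod.smul_mk, Prod.mk_add_mk, ← e1] at this
      exact this
    obtain ⟨h3, h4⟩ := mem_graph_iff_exists.1 h2
    refine ⟨⟨x, hxL, h3⟩, ?_⟩
    change x + L ⟨L ⟨x, hxL⟩, h3⟩ = f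
    rw [h4, ← hyf, e1]
    match_scalars <;> simp

theorem IsRegular.smul_mem_graph {T : E →ₗ.[ℂ] E} (hT : IsRegular B T) (b : B) {x a : E}
    (hx : (x, a) ∈ T.graph) : (b • x, b • a) ∈ T.graph := by
  obtain ⟨h, rfl⟩ := mem_graph_iff_exists.1 hx
  exact mem_graph_iff_exists.2 ⟨hT.smul_mem b x h, hT.map_smul b x h⟩

theorem mem_graph_mulOp_self_add {S T : E →ₗ.[ℂ] E} {x y : E} :
    (x, y) ∈ (mulOp S S + mulOp T T).graph ↔ ∃ a s b t, (x, a) ∈ S.graph ∧ (a, s) ∈ S.graph ∧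
      (x, b) ∈ T.graph ∧ (b, t) ∈ T.graph ∧ s + t = y := by
  rw [mem_graph_iff_exists]
  constructor
  · rintro ⟨⟨⟨h1, h2⟩, ⟨h3, h4⟩⟩, rfl⟩
    exact ⟨_, _, _, _, S.mem_graph ⟨x, h1⟩, S.mem_graph ⟨_, h2⟩, T.mem_graph ⟨x, h3⟩,
      T.mem_graph ⟨_, h4⟩, rfl⟩
  · rintro ⟨a, s, b, t, h1, h2, h3, h4, rfl⟩
    obtain ⟨hS, rfl⟩ := mem_graph_iff_exists.1 h1
    obtain ⟨hS', rfl⟩ := mem_graph_iff_exists.1 h2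
    obtain ⟨hT, rfl⟩ := mem_graph_iff_exists.1 h3
    obtain ⟨hT', rfl⟩ := mem_graph_iff_exists.1 h4
    exact ⟨⟨⟨hS, hS'⟩, ⟨hT, hT'⟩⟩, rfl⟩

theorem mem_graph_of_secondOrderGraph {S T : E →ₗ.[ℂ] E} (ν : ℂ)
    (p : secondOrderGraph S.graph T.graph) :
    ((p.1.1 : E × E × E).1, shiftedLaplacian S.graph T.graph ν p - ν • (p.1.1 : E × E × E).1) ∈
      (mulOp S S + mulOp T T).graph := by
  obtain ⟨⟨⟨⟨x, a, b⟩, hx⟩, ⟨⟨a', s, c⟩, ha⟩, ⟨⟨b', d, t⟩, hb⟩⟩, h1, h2⟩ := p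
  simp only at h1 h2
  subst h1 h2
  refine mem_graph_mulOp_self_add.2 ⟨a', s, b', t, hx.1, ha.1, hx.2, hb.2, ?_⟩
  change s + t = s + t + ν • x - ν • x
  rw [add_sub_cancel_right]

theorem IsWeaklyCommuting.isSelfAdjointOp_isRegular [CompleteSpace E] {S T : E →ₗ.[ℂ] E}
    (h : IsWeaklyCommuting B S T) : IsSelfAdjointOp B (mulOp S S + mulOp T T) ∧
      IsRegular B (mulOp S S + mulOp T T) := by
  have hg := h.isWeaklyCommutingGraph
  obtain ⟨m, hm, hsurj⟩ := hg.exists_surjective_shiftedLaplacian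
  have hsurj' : ∀ f : E, ∃ x a, (x, a) ∈ (mulOp S S + mulOp T T).graph ∧
      a + ((m ^ 2 : ℝ) : ℂ) • x = f := by
    intro f
    obtain ⟨p, hp⟩ := hsurj f
    refine ⟨_, _, mem_graph_of_secondOrderGraph ((m : ℂ) ^ 2) p, ?_⟩
    rw [hp, ofReal_pow, sub_add_cancel]
  have hdense : Dense ((mulOp S S + mulOp T T).domain : Set E) := by
    refine hg.dense_secondOrderGraph.mono ?_
    rintro _ ⟨p, rfl⟩
    exact LinearPMap.mem_domain_of_mem_graph (mem_graph_of_secondOrderGraph 0 p)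
  have hsa : IsSelfAdjointOp B (mulOp S S + mulOp T T) := by
    refine isSelfAdjointOp_of_surjective hdense ?_ hsurj'
    intro x y x' y' hx hx'
    obtain ⟨a, s, b, t, h1, h2, h3, h4, rfl⟩ := mem_graph_mulOp_self_add.1 hx
    obtain ⟨a', s', b', t', h1', h2', h3', h4', rfl⟩ := mem_graph_mulOp_self_add.1 hx'
    rw [CStarModule.inner_add_left, CStarModule.inner_add_right, hg.left.symm h2 h1',
      hg.left.symm h1 h2', hg.right.symm h4 h3', hg.right.symm h3 h4']
  refine ⟨hsa, isRegular_of_surjective hsa ?_ ?_ (by positivity) hsurj'⟩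
  · intro x y hx
    obtain ⟨a, s, b, t, h1, h2, h3, h4, rfl⟩ := mem_graph_mulOp_self_add.1 hx
    rw [CStarModule.inner_add_left, hg.left.symm h2 h1, hg.right.symm h4 h3]
    exact add_nonneg CStarModule.inner_self_nonneg CStarModule.inner_self_nonneg
  · intro r x y hx
    obtain ⟨a, s, b, t, h1, h2, h3, h4, rfl⟩ := mem_graph_mulOp_self_add.1 hx
    rw [smul_add_of_inner]
    exact mem_graph_mulOp_self_add.2 ⟨r • a, r • s, r • b, r • t,
      h.regular_left.smul_mem_graph r h1, h.regular_left.smul_mem_graph r h2,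
      h.regular_right.smul_mem_graph r h3, h.regular_right.smul_mem_graph r h4, rfl⟩

/-- The domain of `A* A` for `A = S ± i T`. -/
theorem IsWeaklyCommuting.domain_adjoint_mulOp [CompleteSpace E] {S T A : E →ₗ.[ℂ] E}
    (h : IsWeaklyCommuting B S T) {ζ : ℂ} (hζ : ζ = I ∨ ζ = -I)
    (hA : ∀ {x y : E}, (x, y) ∈ A.graph ↔ ∃ p : jointGraph S.graph T.graph,
      (p : E × E × E).1 = x ∧ addSMul S.graph T.graph ζ p = y) :
    (mulOp S S).domain ⊓ (mulOp T T).domain = (mulOp (adjoint B A) A).domain := by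
  have hg := h.isWeaklyCommutingGraph
  have hζs : star ζ = -ζ := by rcases hζ with rfl | rfl <;> simp
  have hadj : ∀ y : E, y ∈ (adjoint B A).domain ↔
      ∃ q : jointGraph S.graph T.graph, (q : E × E × E).1 = y := by
    intro y
    rw [mem_adjoint_domain]
    constructor
    · rintro ⟨z, hz⟩
      obtain ⟨q, hq, -⟩ := hg.exists_of_inner_addSMul_eq (y := y) (z := z) hζ fun w => by
        obtain ⟨hw, hw'⟩ := mem_graph_iff_exists.1 (hA.2 ⟨w, rfl, rfl⟩)
        rw [← hw']
        exact hz ⟨_, hw⟩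
      exact ⟨q, hq⟩
    · rintro ⟨q, rfl⟩
      refine ⟨addSMul S.graph T.graph (-ζ) q, fun x => ?_⟩
      obtain ⟨p, hp, hp'⟩ := hA.1 (A.mem_graph x)
      rw [← hp, ← hp', inner_addSMul_left hg.left hg.right hζs]
  ext x
  rw [mem_mulOp_domain, Submodule.mem_inf]
  constructor
  · rintro ⟨⟨h1, h2⟩, ⟨h3, h4⟩⟩
    -- Here `Sx` and `Tx` lie in `D(S) ∩ D(T)`, hence so does `Ax`, and this intersection is the
    -- domain of `A*`.
    obtain ⟨⟨p, p₁, p₂⟩, ⟨hp₁, hp₂⟩, hp⟩ := hg.exists_secondOrderGraph_of_mem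
      (S.mem_graph ⟨x, h1⟩) (S.mem_graph ⟨_, h2⟩) (T.mem_graph ⟨x, h3⟩) (T.mem_graph ⟨_, h4⟩)
    simp only at hp₁ hp₂ hp
    obtain ⟨hx, hx'⟩ := mem_graph_iff_exists.1 (hA.2 ⟨p, rfl, rfl⟩)
    have e : (p : E × E × E).1 = x := by rw [hp]
    subst e
    refine ⟨hx, ?_⟩
    rw [hx', hadj]
    refine ⟨p₁ + ζ • p₂, ?_⟩
    change (p₁ : E × E × E).1 + ζ • (p₂ : E × E × E).1 = _
    rw [hp₁, hp₂, addSMul_apply]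
  · rintro ⟨hx, hx'⟩
    obtain ⟨q, hq⟩ := (hadj _).1 hx'
    obtain ⟨p, hp, hp'⟩ := hA.1 (A.mem_graph ⟨x, hx⟩)
    -- Conversely, `Ax` lies in the joint domain and second order regularity puts `x` in `D(S²) ∩
    -- D(T²)`.
    obtain ⟨P, hP, rfl⟩ := hg.exists_secondOrderGraph hζ p q (hq.trans hp'.symm)
    have := LinearPMap.mem_domain_of_mem_graph (mem_graph_of_secondOrderGraph 0 ⟨P, hP⟩)
    simp only at hp
    rw [hp] at this
    exact this

theorem mem_graph_add_smul {S T : E →ₗ.[ℂ] E} (ζ : ℂ) {x y : E} :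
    (x, y) ∈ (S + ζ • T).graph ↔ ∃ p : jointGraph S.graph T.graph,
      (p : E × E × E).1 = x ∧ addSMul S.graph T.graph ζ p = y := by
  rw [mem_graph_iff_exists]
  constructor
  · rintro ⟨⟨h1, h2⟩, rfl⟩
    exact ⟨⟨(x, S ⟨x, h1⟩, T ⟨x, h2⟩), S.mem_graph ⟨x, h1⟩, T.mem_graph ⟨x, h2⟩⟩, rfl, rfl⟩
  · rintro ⟨⟨⟨x, a, b⟩, hx⟩, rfl, rfl⟩
    rw [mem_jointGraph] at hx
    simp only at hx
    obtain ⟨h1, e1⟩ := mem_graph_iff_exists.1 hx.1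
    obtain ⟨h2, e2⟩ := mem_graph_iff_exists.1 hx.2
    refine ⟨⟨h1, h2⟩, ?_⟩
    change S ⟨x, h1⟩ + ζ • T ⟨x, h2⟩ = a + ζ • b
    rw [e1, e2]

theorem sub_smul_eq_add_neg_smul (S T : E →ₗ.[ℂ] E) (ζ : ℂ) : S - ζ • T = S + (-ζ) • T := by
  refine LinearPMap.ext rfl fun x hx hx' => ?_
  change S ⟨x, hx.1⟩ - ζ • T ⟨x, hx.2⟩ = S ⟨x, hx.1⟩ + (-ζ) • T ⟨x, hx.2⟩
  rw [neg_smul, sub_eq_add_neg]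

end Final

end HilbertModule

theorem mainTheorem4 {B E : Type*} [NonUnitalCStarAlgebra B] [PartialOrder B] [StarOrderedRing B]
    [NormedAddCommGroup E] [NormedSpace ℂ E] [SMul B E] [CStarModule B E] [CompleteSpace E]
    (S T : E →ₗ.[ℂ] E) (hST : HilbertModule.IsWeaklyCommuting B S T) :
    (HilbertModule.mulOp S S + HilbertModule.mulOp T T).domain =
        (HilbertModule.mulOp S S).domain ⊓ (HilbertModule.mulOp T T).domain ∧
      HilbertModule.IsSelfAdjointOp B (HilbertModule.mulOp S S + HilbertModule.mulOp T T) ∧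
      HilbertModule.IsRegular B (HilbertModule.mulOp S S + HilbertModule.mulOp T T) ∧
      (HilbertModule.mulOp S S).domain ⊓ (HilbertModule.mulOp T T).domain =
        (HilbertModule.mulOp (HilbertModule.adjoint B (S + Complex.I • T))
          (S + Complex.I • T)).domain ∧
      (HilbertModule.mulOp S S).domain ⊓ (HilbertModule.mulOp T T).domain =
        (HilbertModule.mulOp (HilbertModule.adjoint B (S - Complex.I • T))
          (S - Complex.I • T)).domain := by
  obtain ⟨hsa, hreg⟩ := hST.isSelfAdjointOp_isRegular
  refine ⟨rfl, hsa, hreg, ?_, ?_⟩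
  · exact hST.domain_adjoint_mulOp (.inl rfl) (HilbertModule.mem_graph_add_smul _)
  · rw [HilbertModule.sub_smul_eq_add_neg_smul]
    exact hST.domain_adjoint_mulOp (.inr rfl) (HilbertModule.mem_graph_add_smul _)
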